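/- Let $\mathcal{B}_1\subset\mathbb{R}^2$ be the unit disc centered at the origin, let $r=|\vec r|$, and let $L=-i\,\partial/\partial\vartheta=-i(x\partial_y-y\partial_x)$ be the angular momentum. For $\varepsilon>0$ and $\Omega\in\mathbb{R}$ define the Gross–Pitaevskii functional $$\mathcal{E}^{\mathrm{GP}}[\Psi]=\int_{\mathcal{B}_1}\Big\{|\nabla\Psi|^2-\Omega\,\Psi^*L\Psi+\frac{|\Psi|^4}{\varepsilon^2}\Big\}\,d\vec r,\qquad \Psi\in H^1(\mathcal{B}_1;\mathbb{C}),$$ (no boundary condition, i.e. the free or Neumann case), and the ground state energy $$E^{\mathrm{GP}}_\varepsilon=\inf\big\{\mathcal{E}^{\mathrm{GP}}[\Psi] : \Psi\in H^1(\mathcal{B}_1;\mathbb{C}),\ \|\Psi\|_{L^2(\mathcal{B}_1)}=1\big\}.$$ Let $\Omega_0>0$ be fixed, independent of $\varepsilon$, and take $\Omega=\Omega(\varepsilon)=\Omega_0/\varepsilon$. Define the Thomas–Fermi functional $$\mathcal{E}^{\mathrm{TF}}[\rho]=\int_{\mathcal{B}_1}\Big\{\rho^2-\frac{\Omega_0^2r^2\rho}{4}\Big\}\,d\vec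 r$$ on $\{\rho\in L^2(\mathcal{B}_1):\rho\ge 0,\ \int_{\mathcal{B}_1}\rho=1\}$. **Theorem.** For every $\Omega_0>0$ the Thomas–Fermi functional attains a minimum value $E^{\mathrm{TF}}$ on this set, and there are constants $C>0$ and $\varepsilon_0>0$, depending only on $\Omega_0$, such that for all $0<\varepsilon<\varepsilon_0$ the energy $E^{\mathrm{GP}}_\varepsilon$ (with $\Omega=\Omega_0/\varepsilon$) is finite and $$\big|\varepsilon^2E^{\mathrm{GP}}_\varepsilon-E^{\mathrm{TF}}\big|\le C\,\varepsilon|\log\varepsilon| .$$ That is, $\varepsilon^2E^{\mathrm{GP}}_\varepsilon=E^{\mathrm{TF}}+O(\varepsilon|\log\varepsilon|)$ as $\varepsilon\to0$. -/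

import Mathlib

open MeasureTheory Set
open scoped ContDiff

namespace RotatingCondensate

/-- The open unit disc `𝓑₁`; the plane `ℝ²` is identified with `ℂ` via `(x, y) ↦ x + i y`. -/
def unitDisc : Set ℂ := Metric.ball (0 : ℂ) 1

/-- Lebesgue measure on the unit disc. -/
noncomputable def discMeasure : Measure ℂ := (volume : Measure ℂ).restrict unitDisc

/-- `g` is the weak partial derivative of `f` in the direction `v` on the unit disc:
`∫ (∂ᵥφ) f = - ∫ φ g` for all real test functions `φ ∈ C_c^∞(𝓑₁)`. -/
def HasWeakPartial (v : ℂ) (f g : ℂ → ℂ) : Prop :=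
  ∀ φ : ℂ → ℝ, ContDiff ℝ ∞ φ → HasCompactSupport φ → tsupport φ ⊆ unitDisc →
    ∫ z, (fderiv ℝ φ z v) • f z ∂discMeasure = -∫ z, φ z • g z ∂discMeasure

/-- An element of the Sobolev space `H¹(𝓑₁)` of complex-valued functions: a representative
`toFun` in `L²(𝓑₁)` together with its (almost everywhere unique) weak partial derivatives
`dx = ∂ₓΨ` and `dy = ∂ᵧΨ`, which are again in `L²(𝓑₁)`. No boundary condition is imposed. -/
structure H1Disc where
  toFun : ℂ → ℂ
  dx : ℂ → ℂ
  dy : ℂ → ℂ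
  memLp_toFun : MemLp toFun 2 discMeasure
  memLp_dx : MemLp dx 2 discMeasure
  memLp_dy : MemLp dy 2 discMeasure
  weak_dx : HasWeakPartial 1 toFun dx
  weak_dy : HasWeakPartial Complex.I toFun dy

/-- The angular momentum `L Ψ = -i ∂_ϑ Ψ = -i (x ∂ᵧΨ - y ∂ₓΨ)`. -/
noncomputable def H1Disc.angularMomentum (Ψ : H1Disc) (z : ℂ) : ℂ :=
  -Complex.I * ((z.re : ℂ) * Ψ.dy z - (z.im : ℂ) * Ψ.dx z)

/-- The quadratic part `∫ |∇Ψ|² - Ω Ψ* L Ψ` of the Gross-Pitaevskii functional. (The integral of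
`Ψ* L Ψ` over the disc is real since `L` is symmetric, so it is the integral of the real part.) -/
noncomputable def gpQuadratic (Ω : ℝ) (Ψ : H1Disc) : ℝ :=
  ∫ z, (‖Ψ.dx z‖ ^ 2 + ‖Ψ.dy z‖ ^ 2
    - Ω * ((starRingEnd ℂ) (Ψ.toFun z) * Ψ.angularMomentum z).re) ∂discMeasure

/-- The Gross-Pitaevskii functional `∫ |∇Ψ|² - Ω Ψ* L Ψ + |Ψ|⁴ / ε²` on `H¹(𝓑₁)`. The quadratic
part is always an absolutely convergent integral; the quartic part is the Lebesgue integral of a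
nonnegative function (it is finite by the Sobolev embedding `H¹ ⊆ L⁴`), so that the sum is written
as an extended real number. -/
noncomputable def gpFunctional (Ω ε : ℝ) (Ψ : H1Disc) : EReal :=
  (gpQuadratic Ω Ψ : EReal) +
    ((∫⁻ z, ENNReal.ofReal (‖Ψ.toFun z‖ ^ 4 / ε ^ 2) ∂discMeasure : ENNReal) : EReal)

/-- The Gross-Pitaevskii ground state energy: the infimum of the functional over all
`Ψ ∈ H¹(𝓑₁)` with `‖Ψ‖₂ = 1`. -/
noncomputable def gpGroundStateEnergy (Ω ε : ℝ) : EReal :=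
  sInf {E : EReal | ∃ Ψ : H1Disc, ∫ z, ‖Ψ.toFun z‖ ^ 2 ∂discMeasure = 1 ∧
    E = gpFunctional Ω ε Ψ}

/-- The Thomas-Fermi functional `∫ ρ² - Ω₀² r² ρ / 4`. -/
noncomputable def tfFunctional (Ω₀ : ℝ) (ρ : ℂ → ℝ) : ℝ :=
  ∫ z, (ρ z ^ 2 - Ω₀ ^ 2 * ‖z‖ ^ 2 * ρ z / 4) ∂discMeasure

/-- The values of the Thomas-Fermi functional on nonnegative `ρ ∈ L²(𝓑₁)` with `∫ ρ = 1`. -/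
def tfValues (Ω₀ : ℝ) : Set ℝ :=
  {E : ℝ | ∃ ρ : ℂ → ℝ, MemLp ρ 2 discMeasure ∧ (∀ᵐ z ∂discMeasure, 0 ≤ ρ z) ∧
    ∫ z, ρ z ∂discMeasure = 1 ∧ E = tfFunctional Ω₀ ρ}

end RotatingCondensate

namespace RotatingCondensate

/-! ### Integration on the disc -/

/-! Completing the square turns the rotation term into a magnetic one: the quadratic part equals `∫
|(∇ - iA)Ψ|² - Ω² r² |Ψ|² / 4` with `A = Ω/2 (-y, x)` (`magneticDensity_sub`). For `Ω = Ω₀/ε` the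
remaining terms are exactly `ε⁻²` times the Thomas-Fermi functional of `|Ψ|²` (`gpFunctional_eq`).
Dropping the magnetic energy gives the lower bound `ε² E_GP ≥ E_TF` with no error
(`le_gpFunctional`).

For the upper bound a trial function must have modulus squared close to the Thomas-Fermi minimizer
and magnetic energy only `O(|log ε| / ε)`. The field `Ω` is compensated by a square lattice of
vortices with one flux quantum per cell, so the spacing is `1/m` with `2π m² ≈ Ω`. An explicit
function `vortex` has `|v|² = V = 1 - sin²(πmx) sin²(πmy)` and covariant derivatives `O(m)`. The
trial function is `√(s/(V + ε)) v`, normalized, where `s` is the Thomas-Fermi density smoothed at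
scale `ε`. The division restores the modulus `√s` outside vortex cores of radius about `√ε/m`.

Both errors come from `∫ 1/(V + ε) = O(|log ε|)` (`integral_inv_latticeSq_le`). The kinetic energy
is at most of order `1/ε + m² ∫ 1/(V + ε)`, with `m² = O(1/ε)` (`magneticDensity_trial_le`). The
density is wrong by `O(ε + ε/(V + ε))` (`abs_density_sub_le`), and the Thomas-Fermi energy is stable
under such `L¹` perturbations (`tfFunctional_normalize_le`). After multiplication by `ε²` everything
is `O(ε |log ε|)`. -/

instance : IsFiniteMeasure discMeasure :=
  ⟨by simp [discMeasure, unitDisc]⟩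

lemma discMeasure_real_univ : discMeasure.real univ = Real.pi := by
  simp [discMeasure, unitDisc, Measure.real]

lemma ae_mem_unitDisc : ∀ᵐ z ∂discMeasure, z ∈ unitDisc :=
  ae_restrict_mem Metric.isOpen_ball.measurableSet

lemma norm_lt_one_of_mem {z : ℂ} (hz : z ∈ unitDisc) : ‖z‖ < 1 := by
  simpa [unitDisc] using hz

lemma _root_.Continuous.integrable_disc {E : Type*} [NormedAddCommGroup E] {f : ℂ → E}
    (hf : Continuous f) : Integrable f discMeasure :=
  (hf.continuousOn.integrableOn_compact (isCompact_closedBall (0 : ℂ) 1)).mono_set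
    Metric.ball_subset_closedBall

lemma _root_.Continuous.memLp_disc {E : Type*} [NormedAddCommGroup E] [SecondCountableTopology E]
    {f : ℂ → E} (hf : Continuous f) : MemLp f 2 discMeasure :=
  (memLp_two_iff_integrable_sq_norm hf.aestronglyMeasurable).2
    (hf.norm.pow 2).integrable_disc

/-- Monotonicity of the integral over the disc, with the inequality needed only on the disc. -/
lemma integral_disc_mono {f g : ℂ → ℝ} (hf : Integrable f discMeasure)
    (hg : Integrable g discMeasure) (h : ∀ z ∈ unitDisc, f z ≤ g z) :
    ∫ z, f z ∂discMeasure ≤ ∫ z, g z ∂discMeasure :=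
  integral_mono_ae hf hg (ae_mem_unitDisc.mono h)

/-! ### The Thomas-Fermi minimizer -/

/-- The Thomas-Fermi profile `[μ + Ω₀² r² / 8]₊` with chemical potential `μ`. -/
noncomputable def tfDensity (Ω₀ μ : ℝ) (z : ℂ) : ℝ := max (μ + Ω₀ ^ 2 / 8 * ‖z‖ ^ 2) 0

lemma continuous_tfDensity (Ω₀ μ : ℝ) : Continuous (tfDensity Ω₀ μ) := by
  unfold tfDensity; fun_prop

lemma tfDensity_nonneg (Ω₀ μ : ℝ) (z : ℂ) : 0 ≤ tfDensity Ω₀ μ z := le_max_right _ _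

/-- Intermediate value theorem in `μ`: the mass is Lipschitz with constant the area `π`, vanishes at
`μ = -Ω₀²/8`, and is at least `π > 1` at `μ = 1`. -/
lemma exists_tfDensity_mass (Ω₀ : ℝ) :
    ∃ μ : ℝ, ∫ z, tfDensity Ω₀ μ z ∂discMeasure = 1 := by
  have hcont : Continuous fun μ : ℝ => ∫ z, tfDensity Ω₀ μ z ∂discMeasure := by
    refine LipschitzWith.continuous (K := Real.toNNReal Real.pi) (LipschitzWith.of_dist_le_mul ?_)
    intro a b
    rw [Real.dist_eq, ← integral_sub (continuous_tfDensity Ω₀ a).integrable_disc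
      (continuous_tfDensity Ω₀ b).integrable_disc]
    have := norm_integral_le_of_norm_le_const (μ := discMeasure) (C := |a - b|)
      (f := fun z => tfDensity Ω₀ a z - tfDensity Ω₀ b z) (ae_of_all _ fun z => by
        have h := abs_max_sub_max_le_abs (a + Ω₀ ^ 2 / 8 * ‖z‖ ^ 2) (b + Ω₀ ^ 2 / 8 * ‖z‖ ^ 2) 0
        rwa [add_sub_add_right_eq_sub] at h)
    rw [discMeasure_real_univ] at this
    rw [Real.coe_toNNReal _ Real.pi_pos.le, Real.dist_eq, mul_comm]
    exact this
  have h0 : ∫ z, tfDensity Ω₀ (-(Ω₀ ^ 2 / 8)) z ∂discMeasure = 0 := by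
    refine integral_eq_zero_of_ae (ae_mem_unitDisc.mono fun z hz => ?_)
    have hz1 := norm_lt_one_of_mem hz
    refine max_eq_right ?_
    have : ‖z‖ ^ 2 ≤ 1 := by nlinarith [norm_nonneg z]
    nlinarith [sq_nonneg Ω₀]
  have h1 : 1 ≤ ∫ z, tfDensity Ω₀ 1 z ∂discMeasure := by
    calc (1 : ℝ) ≤ Real.pi := by linarith [Real.pi_gt_three]
      _ = ∫ _, (1 : ℝ) ∂discMeasure := by simp [discMeasure_real_univ]
      _ ≤ _ := integral_mono (integrable_const _) (continuous_tfDensity Ω₀ 1).integrable_disc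
        fun z => le_max_of_le_left (by simp only []; nlinarith [mul_nonneg (sq_nonneg Ω₀) (sq_nonneg ‖z‖)])
  have := mem_range_of_exists_le_of_exists_ge hcont ⟨_, h0.le.trans zero_le_one⟩ ⟨_, h1⟩
  simpa using this

lemma integrable_normSq_mul {ρ : ℂ → ℝ} (hρ : Integrable ρ discMeasure) :
    Integrable (fun z => ‖z‖ ^ 2 * ρ z) discMeasure := by
  refine hρ.mono (by
    exact (by fun_prop : Continuous fun z : ℂ => ‖z‖ ^ 2).aestronglyMeasurable.mul hρ.1) ?_
  filter_upwards [ae_mem_unitDisc] with z hz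
  have hz1 := norm_lt_one_of_mem hz
  rw [norm_mul, Real.norm_of_nonneg (by positivity)]
  have : ‖z‖ ^ 2 ≤ 1 := by nlinarith [norm_nonneg z]
  nlinarith [norm_nonneg (ρ z)]

lemma tfFunctional_eq (Ω₀ : ℝ) {ρ : ℂ → ℝ} (hρ : MemLp ρ 2 discMeasure) :
    tfFunctional Ω₀ ρ = ∫ z, ρ z ^ 2 ∂discMeasure
      - Ω₀ ^ 2 / 4 * ∫ z, ‖z‖ ^ 2 * ρ z ∂discMeasure := by
  have hi := integrable_normSq_mul (hρ.integrable one_le_two)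
  rw [← integral_const_mul, ← integral_sub hρ.integrable_sq (hi.const_mul _), tfFunctional]
  congr 1 with z
  ring

lemma integrable_tfFunctional (Ω₀ : ℝ) {ρ : ℂ → ℝ} (hρ : MemLp ρ 2 discMeasure) :
    Integrable (fun z => ρ z ^ 2 - Ω₀ ^ 2 * ‖z‖ ^ 2 * ρ z / 4) discMeasure := by
  refine (hρ.integrable_sq.sub
    ((integrable_normSq_mul (hρ.integrable one_le_two)).const_mul (Ω₀ ^ 2 / 4))).congr
    (ae_of_all _ fun z => ?_)
  simp only [Pi.sub_apply]
  ring

/-- Lagrange multiplier argument: with the term `-2μρ` added, the integrand is `ρ² - 2ρ(μ + Ω₀²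
r²/8)`, which `tfDensity` minimizes over `ρ ≥ 0` at each point. The added term has the same integral
for all competitors, since the masses agree. -/
lemma tfDensity_isLeast {Ω₀ μ : ℝ} (hμ : ∫ z, tfDensity Ω₀ μ z ∂discMeasure = 1) :
    IsLeast (tfValues Ω₀) (tfFunctional Ω₀ (tfDensity Ω₀ μ)) := by
  have hL := (continuous_tfDensity Ω₀ μ).memLp_disc
  refine ⟨⟨_, hL, ae_of_all _ (tfDensity_nonneg Ω₀ μ), hμ, rfl⟩, ?_⟩
  rintro _ ⟨σ, hσ, hσ0, hσ1, rfl⟩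
  have hi : Integrable (fun z => 2 * μ * (σ z - tfDensity Ω₀ μ z)) discMeasure :=
    ((hσ.integrable one_le_two).sub (hL.integrable one_le_two)).const_mul _
  have hz : ∫ z, 2 * μ * (σ z - tfDensity Ω₀ μ z) ∂discMeasure = 0 := by
    rw [integral_const_mul, integral_sub (hσ.integrable one_le_two) (hL.integrable one_le_two),
      hσ1, hμ]
    ring
  have hle : tfFunctional Ω₀ (tfDensity Ω₀ μ)
      + ∫ z, 2 * μ * (σ z - tfDensity Ω₀ μ z) ∂discMeasure ≤ tfFunctional Ω₀ σ := by
    unfold tfFunctional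
    rw [← integral_add (integrable_tfFunctional Ω₀ hL) hi]
    refine integral_mono_ae ((integrable_tfFunctional Ω₀ hL).add hi)
      (integrable_tfFunctional Ω₀ hσ) ?_
    filter_upwards [hσ0] with z hz
    simp only [tfDensity]
    rcases le_total (μ + Ω₀ ^ 2 / 8 * ‖z‖ ^ 2) 0 with h | h
    · rw [max_eq_right h]
      nlinarith [mul_nonneg hz (neg_nonneg.2 h)]
    · rw [max_eq_left h]
      nlinarith [sq_nonneg (σ z - (μ + Ω₀ ^ 2 / 8 * ‖z‖ ^ 2))]
  linarith

/-! ### Completing the square and the lower bound -/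

/-- The pointwise magnetic kinetic energy density with vector potential `Ω/2 (-y, x)`. -/
noncomputable def magneticDensity (Ω : ℝ) (z f fx fy : ℂ) : ℝ :=
  ‖fx + Complex.I * (Ω / 2 * z.im : ℝ) * f‖ ^ 2 + ‖fy - Complex.I * (Ω / 2 * z.re : ℝ) * f‖ ^ 2

lemma magneticDensity_nonneg (Ω : ℝ) (z f fx fy : ℂ) : 0 ≤ magneticDensity Ω z f fx fy := by
  unfold magneticDensity; positivity

/-- Expanding the two squares, the cross terms are the rotation term and the squared potential
contributes `|A|² |f|² = Ω² r² |f|² / 4`. -/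
lemma magneticDensity_sub (Ω : ℝ) (z f fx fy : ℂ) :
    ‖fx‖ ^ 2 + ‖fy‖ ^ 2
      - Ω * ((starRingEnd ℂ) f * (-Complex.I * ((z.re : ℂ) * fy - (z.im : ℂ) * fx))).re
    = magneticDensity Ω z f fx fy - Ω ^ 2 / 4 * (‖z‖ ^ 2 * ‖f‖ ^ 2) := by
  simp only [magneticDensity, ← Complex.normSq_eq_norm_sq, Complex.normSq_apply]
  simp
  ring

lemma H1Disc.memLp_covariant (Ψ : H1Disc) (Ω : ℝ) :
    MemLp (fun z => Ψ.dx z + Complex.I * (Ω / 2 * z.im : ℝ) * Ψ.toFun z) 2 discMeasure ∧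
    MemLp (fun z => Ψ.dy z - Complex.I * (Ω / 2 * z.re : ℝ) * Ψ.toFun z) 2 discMeasure := by
  have key : ∀ c : ℂ → ℂ, Continuous c → (∀ z ∈ unitDisc, ‖c z‖ ≤ |Ω|) →
      MemLp (fun z => c z * Ψ.toFun z) 2 discMeasure := by
    intro c hc hb
    refine Ψ.memLp_toFun.of_le_mul (c := |Ω|)
      (hc.aestronglyMeasurable.mul Ψ.memLp_toFun.1) ?_
    filter_upwards [ae_mem_unitDisc] with z hz
    rw [norm_mul]
    exact mul_le_mul_of_nonneg_right (hb z hz) (norm_nonneg _)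
  constructor
  · refine Ψ.memLp_dx.add (key _ (by fun_prop) fun z hz => ?_)
    have h1 := norm_lt_one_of_mem hz
    have h2 := Complex.abs_im_le_norm z
    rw [norm_mul, Complex.norm_I, Complex.norm_real, Real.norm_eq_abs, abs_mul, abs_div, abs_two]
    nlinarith [abs_nonneg Ω, abs_nonneg z.im]
  · refine Ψ.memLp_dy.sub (key _ (by fun_prop) fun z hz => ?_)
    have h1 := norm_lt_one_of_mem hz
    have h2 := Complex.abs_re_le_norm z
    rw [norm_mul, Complex.norm_I, Complex.norm_real, Real.norm_eq_abs, abs_mul, abs_div, abs_two]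
    nlinarith [abs_nonneg Ω, abs_nonneg z.re]

lemma H1Disc.integrable_magneticDensity (Ψ : H1Disc) (Ω : ℝ) :
    Integrable (fun z => magneticDensity Ω z (Ψ.toFun z) (Ψ.dx z) (Ψ.dy z)) discMeasure :=
  (Ψ.memLp_covariant Ω).1.norm.integrable_sq.add (Ψ.memLp_covariant Ω).2.norm.integrable_sq

lemma gpQuadratic_eq (Ω : ℝ) (Ψ : H1Disc) :
    gpQuadratic Ω Ψ = ∫ z, magneticDensity Ω z (Ψ.toFun z) (Ψ.dx z) (Ψ.dy z) ∂discMeasure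
      - Ω ^ 2 / 4 * ∫ z, ‖z‖ ^ 2 * ‖Ψ.toFun z‖ ^ 2 ∂discMeasure := by
  have h := integrable_normSq_mul Ψ.memLp_toFun.norm.integrable_sq
  rw [← integral_const_mul, ← integral_sub (Ψ.integrable_magneticDensity Ω) (h.const_mul _)]
  unfold gpQuadratic H1Disc.angularMomentum
  simp only [magneticDensity_sub]

/-- If the quartic term is finite, the functional is the real number obtained by completing the
square. -/
lemma gpFunctional_eq {Ω₀ ε : ℝ} (hε : 0 < ε) (Ψ : H1Disc)
    (h4 : MemLp (fun z => ‖Ψ.toFun z‖ ^ 2) 2 discMeasure) :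
    gpFunctional (Ω₀ / ε) ε Ψ =
      ((∫ z, magneticDensity (Ω₀ / ε) z (Ψ.toFun z) (Ψ.dx z) (Ψ.dy z) ∂discMeasure
        + tfFunctional Ω₀ (fun z => ‖Ψ.toFun z‖ ^ 2) / ε ^ 2 : ℝ) : EReal) := by
  have hi : Integrable (fun z => ‖Ψ.toFun z‖ ^ 4 / ε ^ 2) discMeasure := by
    refine (h4.integrable_sq.div_const (ε ^ 2)).congr (ae_of_all _ fun z => ?_)
    simp only []
    ring
  rw [gpFunctional, ← ofReal_integral_eq_lintegral_ofReal hi (ae_of_all _ fun z => by positivity),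
    EReal.coe_ennreal_ofReal, max_eq_left (integral_nonneg fun z => by positivity),
    ← EReal.coe_add, gpQuadratic_eq, tfFunctional_eq Ω₀ h4, integral_div]
  have : ∀ z, (‖Ψ.toFun z‖ ^ 2) ^ 2 = ‖Ψ.toFun z‖ ^ 4 := fun z => by ring
  simp only [this]
  congr 1
  field_simp
  ring

lemma le_gpFunctional {Ω₀ ε E : ℝ} (hε : 0 < ε) (hE : E ∈ lowerBounds (tfValues Ω₀)) (Ψ : H1Disc)
    (hΨ : ∫ z, ‖Ψ.toFun z‖ ^ 2 ∂discMeasure = 1) :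
    ((E / ε ^ 2 : ℝ) : EReal) ≤ gpFunctional (Ω₀ / ε) ε Ψ := by
  by_cases h4 : MemLp (fun z => ‖Ψ.toFun z‖ ^ 2) 2 discMeasure
  · rw [gpFunctional_eq hε Ψ h4, EReal.coe_le_coe_iff]
    have h1 : E ≤ tfFunctional Ω₀ (fun z => ‖Ψ.toFun z‖ ^ 2) :=
      hE ⟨_, h4, ae_of_all _ fun z => by positivity, hΨ, rfl⟩
    have h2 : 0 ≤ ∫ z, magneticDensity (Ω₀ / ε) z (Ψ.toFun z) (Ψ.dx z) (Ψ.dy z) ∂discMeasure :=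
      integral_nonneg fun z => magneticDensity_nonneg _ _ _ _ _
    have : E / ε ^ 2 ≤ tfFunctional Ω₀ (fun z => ‖Ψ.toFun z‖ ^ 2) / ε ^ 2 := by gcongr
    linarith
  -- If `|Ψ|²` is not square integrable the functional is `⊤`, so the embedding `H¹ ⊆ L⁴` is not
  -- needed.
  · have htop : ∫⁻ z, ENNReal.ofReal (‖Ψ.toFun z‖ ^ 4 / ε ^ 2) ∂discMeasure = ⊤ := by
      by_contra hne
      have hm : AEStronglyMeasurable (fun z => ‖Ψ.toFun z‖ ^ 4 / ε ^ 2) discMeasure := by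
        simp only [div_eq_mul_inv]
        exact (Ψ.memLp_toFun.1.norm.pow 4).mul_const _
      have hi : Integrable (fun z => ‖Ψ.toFun z‖ ^ 4 / ε ^ 2) discMeasure :=
        (lintegral_ofReal_ne_top_iff_integrable hm (ae_of_all _ fun z => by positivity)).1 hne
      refine h4 ((memLp_two_iff_integrable_sq (Ψ.memLp_toFun.1.norm.pow 2)).2 ?_)
      refine (hi.mul_const (ε ^ 2)).congr (ae_of_all _ fun z => ?_)
      simp only [Pi.pow_apply]
      field_simp
    rw [gpFunctional, htop, EReal.coe_ennreal_top, EReal.coe_add_top]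
    exact le_top

/-! ### Differentiable functions with bounded derivative lie in `H¹` -/

/-- Integration by parts on the whole plane, where `φ` and its derivative vanish off the disc.
Continuity of the derivative of `f` is not required, only its bound on the disc; this suits the
trial function, which is glued from strips. -/
lemma hasWeakPartial_fderiv {f : ℂ → ℂ} (hf : Differentiable ℝ f) {K : ℝ} (v : ℂ)
    (hK : ∀ z ∈ unitDisc, ‖fderiv ℝ f z v‖ ≤ K) :
    HasWeakPartial v f (fun z => fderiv ℝ f z v) := by
  intro φ hφ hφc hφs
  have hφd : Differentiable ℝ φ := hφ.differentiable (by simp)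
  have hφ' : Continuous fun z => fderiv ℝ φ z v :=
    (hφ.continuous_fderiv (by simp)).clm_apply continuous_const
  have hsupp : ∀ z, z ∉ unitDisc → φ z = 0 := fun z hz =>
    image_eq_zero_of_notMem_tsupport fun h => hz (hφs h)
  have hsupp' : ∀ z, z ∉ unitDisc → fderiv ℝ φ z v = 0 := fun z hz => by
    have : z ∉ tsupport (fderiv ℝ φ) := fun h => hz (hφs (tsupport_fderiv_subset ℝ h))
    rw [image_eq_zero_of_notMem_tsupport this]; rfl
  have hc' : HasCompactSupport fun z => fderiv ℝ φ z v :=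
    hφc.fderiv_apply (𝕜 := ℝ) v
  have hg : Integrable (fun z => φ z • fderiv ℝ f z v) := by
    refine ((hφ.continuous.integrable_of_hasCompactSupport hφc).norm.mul_const K).mono'
      (hφ.continuous.aestronglyMeasurable.smul
        (measurable_fderiv_apply_const ℝ f v).aestronglyMeasurable) (ae_of_all _ fun z => ?_)
    by_cases hz : z ∈ unitDisc
    · rw [norm_smul]
      exact mul_le_mul_of_nonneg_left (hK z hz) (norm_nonneg _)
    · simp [hsupp z hz]
  have key := integral_smul_fderiv_eq_neg_fderiv_smul_of_integrable (μ := (volume : Measure ℂ))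
    (f := φ) (g := f) (v := v)
    ((hφ'.smul hf.continuous).integrable_of_hasCompactSupport hc'.smul_right) hg
    ((hφ.continuous.smul hf.continuous).integrable_of_hasCompactSupport hφc.smul_right)
    (fun z _ => hφd z) (fun z _ => hf z)
  unfold discMeasure
  rw [setIntegral_eq_integral_of_forall_compl_eq_zero fun z hz => by simp [hsupp' z hz],
    setIntegral_eq_integral_of_forall_compl_eq_zero fun z hz => by simp [hsupp z hz], key, neg_neg]

lemma memLp_fderiv_apply {f : ℂ → ℂ} {K : ℝ} (v : ℂ)
    (hK : ∀ z ∈ unitDisc, ‖fderiv ℝ f z v‖ ≤ K) :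
    MemLp (fun z => fderiv ℝ f z v) 2 discMeasure :=
  MemLp.of_bound (measurable_fderiv_apply_const ℝ f v).aestronglyMeasurable K
    (ae_mem_unitDisc.mono hK)

/-- The element of `H¹` given by a differentiable function with bounded partial derivatives. -/
noncomputable def H1Disc.ofDifferentiable (f : ℂ → ℂ) (hf : Differentiable ℝ f) (K : ℝ)
    (hx : ∀ z ∈ unitDisc, ‖fderiv ℝ f z 1‖ ≤ K)
    (hy : ∀ z ∈ unitDisc, ‖fderiv ℝ f z Complex.I‖ ≤ K) : H1Disc where
  toFun := f
  dx z := fderiv ℝ f z 1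
  dy z := fderiv ℝ f z Complex.I
  memLp_toFun := hf.continuous.memLp_disc
  memLp_dx := memLp_fderiv_apply 1 hx
  memLp_dy := memLp_fderiv_apply Complex.I hy
  weak_dx := hasWeakPartial_fderiv hf 1 hx
  weak_dy := hasWeakPartial_fderiv hf Complex.I hy

/-! ### The lattice integral -/

/-- Jordan's inequality gives `cos(πx) ≥ 1 - 2x` on `[0, 1/2]`, so for decreasing `h` the cosine may
be replaced by a linear function; the other half follows by reflection. -/
lemma integral_abs_cos_le {h : ℝ → ℝ} (hc : Continuous h) (ha : AntitoneOn h (Icc 0 1)) :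
    ∫ x in (0 : ℝ)..1, h |Real.cos (Real.pi * x)| ≤ ∫ u in (0 : ℝ)..1, h u := by
  have hcc : Continuous fun x => h |Real.cos (Real.pi * x)| := by fun_prop
  have hsplit := intervalIntegral.integral_add_adjacent_intervals
    (hcc.intervalIntegrable 0 (1 / 2)) (hcc.intervalIntegrable (μ := volume) (1 / 2) 1)
  have hrefl : ∫ x in (1 / 2 : ℝ)..1, h |Real.cos (Real.pi * x)|
      = ∫ x in (0 : ℝ)..(1 / 2), h |Real.cos (Real.pi * x)| := by
    have := intervalIntegral.integral_comp_sub_left (a := 0) (b := 1 / 2)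
      (fun x => h |Real.cos (Real.pi * x)|) 1
    rw [show (1 : ℝ) - 1 / 2 = 1 / 2 by norm_num, sub_zero] at this
    rw [← this]
    congr 1 with x
    rw [show Real.pi * (1 - x) = Real.pi - Real.pi * x by ring, Real.cos_pi_sub, abs_neg]
  have hhalf : ∫ x in (0 : ℝ)..(1 / 2), h |Real.cos (Real.pi * x)|
      ≤ ∫ x in (0 : ℝ)..(1 / 2), h (1 - 2 * x) := by
    refine intervalIntegral.integral_mono_on (by norm_num) (hcc.intervalIntegrable _ _)
      ((by fun_prop : Continuous fun x => h (1 - 2 * x)).intervalIntegrable _ _) fun x hx => ?_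
    have h1 := Real.one_sub_mul_le_cos (x := Real.pi * x) (mul_nonneg Real.pi_pos.le hx.1)
      (by nlinarith [hx.2, Real.pi_pos])
    rw [show 2 / Real.pi * (Real.pi * x) = 2 * x by field_simp] at h1
    exact ha ⟨by linarith [hx.2], by linarith [hx.1]⟩ ⟨abs_nonneg _, Real.abs_cos_le_one _⟩
      (h1.trans (le_abs_self _))
  have hsub : ∫ x in (0 : ℝ)..(1 / 2), h (1 - 2 * x) = (1 / 2) * ∫ u in (0 : ℝ)..1, h u := by
    rw [intervalIntegral.integral_comp_sub_mul h two_ne_zero 1]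
    norm_num
  linarith

/-- The integrand has period `1/m`, so `[-1, 1]` contains `2m` periods and the bound does not depend
on `m`. -/
lemma integral_abs_cos_lattice_le {h : ℝ → ℝ} (hc : Continuous h) (ha : AntitoneOn h (Icc 0 1))
    {m : ℕ} (hm : m ≠ 0) :
    ∫ x in (-1 : ℝ)..1, h |Real.cos (Real.pi * (m * x))| ≤ 2 * ∫ u in (0 : ℝ)..1, h u := by
  set F : ℝ → ℝ := fun x => h |Real.cos (Real.pi * x)| with hF
  have hFc : Continuous F := by fun_prop
  have hper : Function.Periodic F 1 := fun x => by
    simp only [hF, mul_add, mul_one, Real.cos_add_pi, abs_neg]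
  have hm' : (m : ℝ) ≠ 0 := Nat.cast_ne_zero.2 hm
  have h1 := intervalIntegral.integral_comp_mul_left (a := -1) (b := 1) F hm'
  have h2 := hper.intervalIntegral_add_zsmul_eq (2 * m) (-m) fun a b => hFc.intervalIntegrable a b
  have h3 : (-m : ℝ) + (2 * m : ℤ) • (1 : ℝ) = m := by push_cast [zsmul_eq_mul]; ring
  have h4 : ∫ x in (-1 : ℝ)..1, F (m * x) = 2 * ∫ u in (0 : ℝ)..1, F u := by
    rw [h1, mul_neg_one, mul_one]
    rw [h3, hper.intervalIntegral_add_eq _ 0, zero_add, zsmul_eq_mul] at h2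
    rw [h2, smul_eq_mul]
    push_cast
    field_simp
  have h5 := integral_abs_cos_le hc ha
  calc _ = ∫ x in (-1 : ℝ)..1, F (m * x) := rfl
    _ ≤ _ := by rw [h4]; linarith

/-- The squared modulus of the vortex lattice function with lattice constant `1 / m`. -/
noncomputable def latticeSq (m : ℕ) (z : ℂ) : ℝ :=
  1 - Real.sin (Real.pi * (m * z.re)) ^ 2 * Real.sin (Real.pi * (m * z.im)) ^ 2

lemma continuous_latticeSq (m : ℕ) : Continuous (latticeSq m) := by
  unfold latticeSq; fun_prop

lemma latticeSq_le_one (m : ℕ) (z : ℂ) : latticeSq m z ≤ 1 := by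
  unfold latticeSq
  nlinarith [mul_nonneg (sq_nonneg (Real.sin (Real.pi * (m * z.re))))
    (sq_nonneg (Real.sin (Real.pi * (m * z.im))))]

lemma cos_sq_le_latticeSq (m : ℕ) (z : ℂ) :
    Real.cos (Real.pi * (m * z.re)) ^ 2 ≤ latticeSq m z ∧
    Real.cos (Real.pi * (m * z.im)) ^ 2 ≤ latticeSq m z := by
  unfold latticeSq
  set a := Real.pi * (m * z.re)
  set b := Real.pi * (m * z.im)
  have ha := Real.sin_sq_add_cos_sq a
  have hb := Real.sin_sq_add_cos_sq b
  constructor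
  · nlinarith [mul_nonneg (sq_nonneg (Real.sin a)) (sq_nonneg (Real.cos b))]
  · nlinarith [mul_nonneg (sq_nonneg (Real.sin b)) (sq_nonneg (Real.cos a))]

lemma latticeSq_nonneg (m : ℕ) (z : ℂ) : 0 ≤ latticeSq m z :=
  (sq_nonneg _).trans (cos_sq_le_latticeSq m z).1

/-- A lower bound separating the two lattice directions. -/
lemma inv_latticeSq_add_le {m : ℕ} {z : ℂ} {ε : ℝ} (hε : 0 < ε) :
    1 / (latticeSq m z + ε) ≤
      6 / (|Real.cos (Real.pi * (m * z.im))| + (|Real.cos (Real.pi * (m * z.re))| + √ε)) ^ 2 := by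
  obtain ⟨h1, h2⟩ := cos_sq_le_latticeSq m z
  have hs := Real.sqrt_pos.2 hε
  have hsq := Real.sq_sqrt hε.le
  rw [← sq_abs] at h1 h2
  set a := |Real.cos (Real.pi * (m * z.re))|
  set b := |Real.cos (Real.pi * (m * z.im))|
  have ha : 0 ≤ a := abs_nonneg _
  have hb : 0 ≤ b := abs_nonneg _
  rw [div_le_div_iff₀ (by nlinarith) (by positivity)]
  -- The constant is `6 = 3 · 2`: `(a + b + √ε)² ≤ 3(a² + b² + ε)` and `a² + b² ≤ 2 latticeSq`.
  nlinarith [sq_nonneg (a - b), sq_nonneg (a - √ε), sq_nonneg (b - √ε)]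

/-- The inner integral over `y`: the square singularity integrates to `1/B`. With `B = |cos(πmx)| +
√ε`, the integral over `x` then yields the logarithm. -/
lemma integral_inv_add_sq_le {m : ℕ} (hm : m ≠ 0) {B : ℝ} (hB : 0 < B) :
    ∫ y in (-1 : ℝ)..1, 6 / (|Real.cos (Real.pi * (m * y))| + B) ^ 2 ≤ 12 / B := by
  have hpos : ∀ u : ℝ, 0 < |u| + B := fun u => by positivity
  have hc : Continuous fun u : ℝ => 6 / (|u| + B) ^ 2 :=
    continuous_const.div (by fun_prop) fun u => (pow_pos (hpos u) 2).ne'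
  have h := integral_abs_cos_lattice_le hc (fun u hu v hv huv => by
    have := hpos u
    simp only [abs_of_nonneg hu.1, abs_of_nonneg hv.1] at this ⊢
    gcongr) hm
  simp only [abs_abs] at h
  refine h.trans ?_
  have hF : ∫ u in (0 : ℝ)..1, 6 / (|u| + B) ^ 2 = -6 / (1 + B) - -6 / (0 + B) := by
    refine intervalIntegral.integral_eq_sub_of_hasDerivAt (f := fun u => -6 / (u + B))
      (fun u hu => ?_) (hc.intervalIntegrable _ _)
    rw [uIcc_of_le zero_le_one] at hu
    have hne : u + B ≠ 0 := by linarith [hu.1]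
    rw [abs_of_nonneg hu.1]
    refine ((hasDerivAt_const u (-6 : ℝ)).div ((hasDerivAt_id u).add_const B) hne).congr_deriv ?_
    simp
  rw [hF, zero_add]
  have : 0 < 6 / (1 + B) := by positivity
  have h3 : -6 / (1 + B) = -(6 / (1 + B)) := by ring
  have h4 : 2 * (-(6 / (1 + B)) - -6 / B) = 12 / B - 2 * (6 / (1 + B)) := by ring
  linarith

lemma integral_inv_add_le {m : ℕ} (hm : m ≠ 0) {B : ℝ} (hB : 0 < B) :
    ∫ x in (-1 : ℝ)..1, 12 / (|Real.cos (Real.pi * (m * x))| + B)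
      ≤ 24 * (Real.log (1 + B) - Real.log B) := by
  have hpos : ∀ u : ℝ, 0 < |u| + B := fun u => by positivity
  have hc : Continuous fun u : ℝ => 12 / (|u| + B) :=
    continuous_const.div (by fun_prop) fun u => (hpos u).ne'
  have h := integral_abs_cos_lattice_le hc (fun u hu v hv huv => by
    have := hpos u
    simp only [abs_of_nonneg hu.1, abs_of_nonneg hv.1] at this ⊢
    gcongr) hm
  simp only [abs_abs] at h
  refine h.trans ?_
  have hF : ∫ u in (0 : ℝ)..1, 12 / (|u| + B) = 12 * Real.log (1 + B) - 12 * Real.log (0 + B) := by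
    refine intervalIntegral.integral_eq_sub_of_hasDerivAt (f := fun u => 12 * Real.log (u + B))
      (fun u hu => ?_) (hc.intervalIntegrable _ _)
    rw [uIcc_of_le zero_le_one] at hu
    have hne : u + B ≠ 0 := by linarith [hu.1]
    rw [abs_of_nonneg hu.1]
    refine ((((hasDerivAt_id u).add_const B).log hne).const_mul 12).congr_deriv ?_
    simp [div_eq_mul_inv]
  rw [hF, zero_add]
  linarith

lemma one_le_abs_log {ε : ℝ} (hε : 0 < ε) (hε4 : ε ≤ 1 / 4) : 1 ≤ |Real.log ε| := by
  have h : Real.log ε ≤ -1 := by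
    rw [Real.log_le_iff_le_exp hε, Real.exp_neg]
    have := Real.exp_one_lt_d9
    have h1 : (1 / 4 : ℝ) ≤ (Real.exp 1)⁻¹ := by
      rw [one_div]
      exact inv_anti₀ (Real.exp_pos 1) (by linarith)
    linarith
  rw [abs_of_nonpos (by linarith)]
  linarith

lemma continuous_inv_latticeSq_add (m : ℕ) {ε : ℝ} (hε : 0 < ε) :
    Continuous fun z => 1 / (latticeSq m z + ε) :=
  continuous_const.div ((continuous_latticeSq m).add continuous_const) fun z =>
    (add_pos_of_nonneg_of_pos (latticeSq_nonneg m z) hε).ne'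

/-- Each vortex core contributes a logarithm. -/
lemma integral_inv_latticeSq_le {m : ℕ} (hm : m ≠ 0) {ε : ℝ} (hε : 0 < ε) (hε4 : ε ≤ 1 / 4) :
    ∫ z, 1 / (latticeSq m z + ε) ∂discMeasure ≤ 24 * |Real.log ε| := by
  have hs : 0 < √ε := Real.sqrt_pos.2 hε
  set G : ℝ × ℝ → ℝ := fun p =>
    6 / (|Real.cos (Real.pi * (m * p.2))| + (|Real.cos (Real.pi * (m * p.1))| + √ε)) ^ 2 with hG
  have hGc : Continuous G :=
    continuous_const.div (by fun_prop) fun p => by positivity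
  have hG0 : ∀ p, 0 ≤ G p := fun p => by positivity
  have hGi : IntegrableOn G (Icc (-1) 1 ×ˢ Icc (-1) 1) :=
    hGc.continuousOn.integrableOn_compact (isCompact_Icc.prod isCompact_Icc)
  have hmp := Complex.volume_preserving_equiv_real_prod
  have hemb := Complex.measurableEquivRealProd.measurableEmbedding
  have hsub : unitDisc ⊆ Complex.measurableEquivRealProd ⁻¹' (Icc (-1) 1 ×ˢ Icc (-1) 1) := by
    intro z hz
    have h1 := norm_lt_one_of_mem hz
    have h2 := abs_le.1 ((Complex.abs_re_le_norm z).trans h1.le)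
    have h3 := abs_le.1 ((Complex.abs_im_le_norm z).trans h1.le)
    exact ⟨⟨h2.1, h2.2⟩, ⟨h3.1, h3.2⟩⟩
  have hGi' : IntegrableOn (fun z => G (Complex.measurableEquivRealProd z))
      (Complex.measurableEquivRealProd ⁻¹' (Icc (-1) 1 ×ˢ Icc (-1) 1)) :=
    (hmp.integrableOn_comp_preimage hemb).2 hGi
  have step1 : ∫ z, 1 / (latticeSq m z + ε) ∂discMeasure
      ≤ ∫ z in unitDisc, G (Complex.measurableEquivRealProd z) :=
    integral_mono (continuous_inv_latticeSq_add m hε).integrable_disc (hGi'.mono_set hsub)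
      fun z => inv_latticeSq_add_le hε
  have step2 : ∫ z in unitDisc, G (Complex.measurableEquivRealProd z)
      ≤ ∫ z in Complex.measurableEquivRealProd ⁻¹' (Icc (-1) 1 ×ˢ Icc (-1) 1),
        G (Complex.measurableEquivRealProd z) :=
    setIntegral_mono_set hGi' (ae_of_all _ fun z => hG0 _) hsub.eventuallyLE
  rw [hmp.setIntegral_preimage_emb hemb G] at step2
  have step3 : ∫ p in Icc (-1 : ℝ) 1 ×ˢ Icc (-1 : ℝ) 1, G p
      ≤ ∫ x in Icc (-1 : ℝ) 1, 12 / (|Real.cos (Real.pi * (m * x))| + √ε) := by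
    rw [Measure.volume_eq_prod, setIntegral_prod G hGi]
    have hi : IntegrableOn (fun x => 12 / (|Real.cos (Real.pi * (m * x))| + √ε)) (Icc (-1 : ℝ) 1) :=
      (Continuous.continuousOn (continuous_const.div (by fun_prop) fun x => by
        positivity)).integrableOn_compact isCompact_Icc
    refine integral_mono_of_nonneg (ae_of_all _ fun x => integral_nonneg fun y => hG0 _) hi
      (ae_of_all _ fun x => ?_)
    have := integral_inv_add_sq_le hm (B := |Real.cos (Real.pi * (m * x))| + √ε) (by positivity)
    rw [intervalIntegral.integral_of_le (by norm_num), ← integral_Icc_eq_integral_Ioc] at this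
    exact this
  have step4 := integral_inv_add_le hm hs
  rw [intervalIntegral.integral_of_le (by norm_num), ← integral_Icc_eq_integral_Ioc] at step4
  have hlog : Real.log √ε = Real.log ε / 2 := Real.log_sqrt hε.le
  -- The total is `24 log(1 + √ε) + 12 |log ε| ≤ 12 + 12 |log ε|`, and `|log ε| ≥ 1` absorbs the
  -- constant.
  have hlog1 : Real.log (1 + √ε) ≤ 1 / 2 := by
    have h1 := Real.log_le_sub_one_of_pos (x := 1 + √ε) (by positivity)
    have h2 : √ε ≤ 1 / 2 := by
      rw [Real.sqrt_le_left (by norm_num)]; linarith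
    linarith
  have hl := one_le_abs_log hε hε4
  have hl2 := neg_abs_le (Real.log ε)
  linarith

/-! ### The vortex lattice function -/

/-- The vortex lattice function on the strip `n ≤ m y ≤ n + 1`: an interpolation between two
neighbouring plane waves, in the symmetric gauge. -/
noncomputable def vortexLocal (Ω : ℝ) (m : ℕ) (n : ℤ) (z : ℂ) : ℂ :=
  Complex.exp (Complex.I * (Ω / 2 * z.re * z.im - 2 * Real.pi * m * n * z.re : ℝ)) *
    (((1 + Real.cos (Real.pi * (m * z.im - n))) / 2 : ℝ) +
      ((1 - Real.cos (Real.pi * (m * z.im - n))) / 2 : ℝ) *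
        Complex.exp (Complex.I * (-(2 * Real.pi * m * z.re) : ℝ)))

/-- The vortex lattice function, glued from the strips. -/
noncomputable def vortex (Ω : ℝ) (m : ℕ) (z : ℂ) : ℂ := vortexLocal Ω m ⌊m * z.im⌋ z

lemma norm_exp_I_mul_ofReal (t : ℝ) : ‖Complex.exp (Complex.I * (t : ℂ))‖ = 1 := by
  rw [mul_comm, Complex.norm_exp_ofReal_mul_I]

/-- With weights `c + s = 1` one has `|c + s e^{iψ}|² = 1 - 4cs sin²(ψ/2)`, and `4cs = sin²(π(my -
n))`. Since `sin²` has period `π`, the modulus does not depend on the strip. -/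
lemma norm_vortexLocal_sq (Ω : ℝ) (m : ℕ) (n : ℤ) (z : ℂ) :
    ‖vortexLocal Ω m n z‖ ^ 2 = latticeSq m z := by
  have h1 : Real.sin (Real.pi * (m * z.im)) ^ 2
      = Real.sin (Real.pi * (m * z.im - n)) ^ 2 := by
    rw [mul_sub, mul_comm Real.pi (n : ℝ), Real.sin_sub_int_mul_pi, mul_pow]
    rcases Int.even_or_odd n with h | h
    · rw [h.neg_one_zpow]; ring
    · rw [h.neg_one_zpow]; ring
  unfold latticeSq
  rw [h1, vortexLocal]
  set T := Real.pi * (m * z.im - n)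
  rw [norm_mul, norm_exp_I_mul_ofReal, one_mul, ← Complex.normSq_eq_norm_sq,
    mul_comm Complex.I, Complex.exp_mul_I, ← Complex.ofReal_cos, ← Complex.ofReal_sin,
    Complex.normSq_apply]
  have h2 : 2 * Real.pi * m * z.re = 2 * (Real.pi * (m * z.re)) := by ring
  simp only [Complex.add_re, Complex.add_im, Complex.mul_re, Complex.mul_im, Complex.ofReal_re,
    Complex.ofReal_im, Complex.I_re, Complex.I_im, Real.cos_neg, Real.sin_neg]
  rw [h2, Real.cos_two_mul, Real.sin_two_mul]
  set X := Real.pi * (m * z.re)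
  have hX := Real.sin_sq_add_cos_sq X
  have hT := Real.sin_sq_add_cos_sq T
  have hX' : Real.cos X ^ 2 = 1 - Real.sin X ^ 2 := by linarith
  have hT' : Real.cos T ^ 2 = 1 - Real.sin T ^ 2 := by linarith
  clear_value X T
  ring_nf
  simp only [hX', hT', show Real.cos X ^ 4 = (1 - Real.sin X ^ 2) ^ 2 by rw [← hX']; ring]
  ring

lemma norm_vortex_sq (Ω : ℝ) (m : ℕ) (z : ℂ) : ‖vortex Ω m z‖ ^ 2 = latticeSq m z :=
  norm_vortexLocal_sq Ω m _ z

/-- On the line `my = n` both strips reduce to the same plane wave, and off it they differ by a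
multiple of `1 - cos(π(my - n))`. This second-order contact makes the glued function differentiable.
-/
lemma vortexLocal_sub_one_sub (Ω : ℝ) (m : ℕ) (n : ℤ) (z : ℂ) :
    ‖vortexLocal Ω m (n - 1) z - vortexLocal Ω m n z‖
      ≤ (Real.pi * (m * z.im - n)) ^ 2 / 2 := by
  have hcos : Real.cos (Real.pi * (m * z.im - (n - 1 : ℤ)))
      = -Real.cos (Real.pi * (m * z.im - n)) := by
    rw [← Real.cos_add_pi]; congr 1; push_cast; ring
  have hexp : Complex.exp (Complex.I * (Ω / 2 * z.re * z.im - 2 * Real.pi * m * (n - 1 : ℤ) * z.re : ℝ))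
      = Complex.exp (Complex.I * (Ω / 2 * z.re * z.im - 2 * Real.pi * m * n * z.re : ℝ))
        * Complex.exp (Complex.I * (2 * Real.pi * m * z.re : ℝ)) := by
    rw [← Complex.exp_add]; congr 1; push_cast; ring
  have hinv : Complex.exp (Complex.I * (2 * Real.pi * m * z.re : ℝ))
      * Complex.exp (Complex.I * (-(2 * Real.pi * m * z.re) : ℝ)) = 1 := by
    rw [← Complex.exp_add, ← Complex.exp_zero]; congr 1; push_cast; ring
  have hdiff : vortexLocal Ω m (n - 1) z - vortexLocal Ω m n z
      = Complex.exp (Complex.I * (Ω / 2 * z.re * z.im - 2 * Real.pi * m * n * z.re : ℝ))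
        * (((1 - Real.cos (Real.pi * (m * z.im - n))) / 2 : ℝ)
          * (Complex.exp (Complex.I * (2 * Real.pi * m * z.re : ℝ))
            - Complex.exp (Complex.I * (-(2 * Real.pi * m * z.re) : ℝ)))) := by
    unfold vortexLocal
    rw [hcos, hexp, sub_neg_eq_add, ← sub_eq_add_neg]
    linear_combination
      (Complex.exp (Complex.I * (Ω / 2 * z.re * z.im - 2 * Real.pi * m * n * z.re : ℝ))
        * ((1 + Real.cos (Real.pi * (m * z.im - n))) / 2 : ℝ)) * hinv
  have hc1 := Real.cos_le_one (Real.pi * (m * z.im - n))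
  rw [hdiff, norm_mul, norm_exp_I_mul_ofReal, one_mul, norm_mul, Complex.norm_real,
    Real.norm_of_nonneg (by linarith)]
  have h2 : ‖Complex.exp (Complex.I * (2 * Real.pi * m * z.re : ℝ))
      - Complex.exp (Complex.I * (-(2 * Real.pi * m * z.re) : ℝ))‖ ≤ 2 := by
    refine (norm_sub_le _ _).trans ?_
    rw [norm_exp_I_mul_ofReal, norm_exp_I_mul_ofReal]
    norm_num
  have h3 := Real.one_sub_sq_div_two_le_cos (x := Real.pi * (m * z.im - n))
  nlinarith

lemma differentiable_re : Differentiable ℝ Complex.re := Complex.reCLM.differentiable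
lemma differentiable_im : Differentiable ℝ Complex.im := Complex.imCLM.differentiable

lemma differentiable_vortexLocal (Ω : ℝ) (m : ℕ) (n : ℤ) :
    Differentiable ℝ (vortexLocal Ω m n) := by
  have hre := differentiable_re
  have him := differentiable_im
  have ho : ∀ g : ℂ → ℝ, Differentiable ℝ g → Differentiable ℝ fun z => (g z : ℂ) :=
    fun g hg => Complex.ofRealCLM.differentiable.comp hg
  have he : ∀ g : ℂ → ℝ, Differentiable ℝ g →
      Differentiable ℝ fun z => Complex.exp (Complex.I * (g z : ℂ)) := fun g hg =>
    ((ho g hg).const_mul _).cexp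
  unfold vortexLocal
  exact (he _ (by fun_prop)).mul ((ho _ (by fun_prop)).add ((ho _ (by fun_prop)).mul
    (he _ (by fun_prop))))

lemma hasFDerivAt_vortex (Ω : ℝ) (m : ℕ) (w : ℂ) :
    HasFDerivAt (vortex Ω m) (fderiv ℝ (vortexLocal Ω m ⌊m * w.im⌋) w) w := by
  set n := ⌊m * w.im⌋ with hn
  have hO : (fun z => vortex Ω m z - vortexLocal Ω m n z) =O[nhds w] fun z => ‖z - w‖ ^ 2 := by
    refine Asymptotics.IsBigO.of_bound ((Real.pi * m) ^ 2) ?_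
    have hc : Continuous fun z : ℂ => (m : ℝ) * z.im := by fun_prop
    have hlo : ∀ᶠ z in nhds w, (n : ℝ) - 1 < m * z.im :=
      hc.continuousAt.eventually_const_lt (by have := Int.floor_le ((m : ℝ) * w.im); linarith)
    have hhi : ∀ᶠ z in nhds w, (m : ℝ) * z.im < n + 1 :=
      hc.continuousAt.eventually_lt_const (Int.lt_floor_add_one _)
    filter_upwards [hlo, hhi] with z h1 h2
    rcases le_or_gt (n : ℝ) (m * z.im) with h | h
    · have : ⌊(m : ℝ) * z.im⌋ = n := Int.floor_eq_iff.2 ⟨h, h2⟩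
      rw [vortex, this, sub_self, norm_zero]
      positivity
    · have : ⌊(m : ℝ) * z.im⌋ = n - 1 := Int.floor_eq_iff.2
        ⟨by push_cast; exact h1.le, by push_cast; linarith⟩
      rw [vortex, this, Real.norm_of_nonneg (by positivity)]
      refine (vortexLocal_sub_one_sub Ω m n z).trans ?_
      have h3 : (n : ℝ) ≤ m * w.im := Int.floor_le _
      have h4 := abs_le.1 (Complex.abs_im_le_norm (z - w))
      rw [Complex.sub_im] at h4
      -- The line `my = n` separates `z` from `w`, as `m z.im < n ≤ m w.im`.
      have h5 : |m * z.im - n| ≤ m * ‖z - w‖ := by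
        rw [abs_le]
        constructor
        · nlinarith [h4.1, (Nat.cast_nonneg m : (0 : ℝ) ≤ m)]
        · nlinarith [norm_nonneg (z - w), (Nat.cast_nonneg m : (0 : ℝ) ≤ m)]
      have h6 : (m * z.im - n) ^ 2 ≤ (m * ‖z - w‖) ^ 2 := sq_le_sq' (abs_le.1 h5).1 (abs_le.1 h5).2
      calc _ ≤ (Real.pi * (m * z.im - n)) ^ 2 := half_le_self (by positivity)
        _ = Real.pi ^ 2 * (m * z.im - n) ^ 2 := by ring
        _ ≤ Real.pi ^ 2 * (m * ‖z - w‖) ^ 2 := by gcongr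
        _ = _ := by ring
  have h := (hO.hasFDerivAt one_lt_two).add (differentiable_vortexLocal Ω m n w).hasFDerivAt
  rw [zero_add] at h
  exact h.congr_of_eventuallyEq (Filter.Eventually.of_forall fun z => by simp)

lemma hasLineDerivAt_vortex {Ω : ℝ} {m : ℕ} {w v q : ℂ}
    (h : HasLineDerivAt ℝ (vortexLocal Ω m ⌊m * w.im⌋) q w v) :
    HasLineDerivAt ℝ (vortex Ω m) q w v := by
  have h1 := (hasFDerivAt_vortex Ω m w).hasLineDerivAt v
  have h2 := (differentiable_vortexLocal Ω m ⌊m * w.im⌋ w).hasFDerivAt.hasLineDerivAt v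
  rwa [HasLineDerivAt.unique h2 h] at h1

/-- The covariant derivative in the direction of `x` is of the order of the inverse lattice
constant. -/
lemma exists_covariant_dx_vortex {Ω : ℝ} {m : ℕ} {w : ℂ} (hw : w ∈ unitDisc)
    (hΩ : |Ω - 2 * Real.pi * m ^ 2| ≤ 4 * Real.pi * m) :
    ∃ q : ℂ, HasLineDerivAt ℝ (vortex Ω m) q w 1 ∧
      ‖q + Complex.I * (Ω / 2 * w.im : ℝ) * vortex Ω m w‖ ≤ 8 * Real.pi * m := by
  set n := ⌊m * w.im⌋ with hn
  set φ : ℝ := Ω / 2 * w.re * w.im - 2 * Real.pi * m * n * w.re with hφ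
  set c : ℝ := (1 + Real.cos (Real.pi * (m * w.im - n))) / 2 with hc
  set s : ℝ := (1 - Real.cos (Real.pi * (m * w.im - n))) / 2 with hs
  set ψ : ℝ := -(2 * Real.pi * m * w.re) with hψ
  have hv : vortex Ω m w = Complex.exp (Complex.I * φ) * (c + s * Complex.exp (Complex.I * ψ)) := rfl
  have hd1 : HasDerivAt (fun t : ℝ => Ω / 2 * (w.re + t) * w.im - 2 * Real.pi * m * n * (w.re + t))
      (Ω / 2 * w.im - 2 * Real.pi * m * n) 0 := by
    refine (((((hasDerivAt_id (0 : ℝ)).const_add w.re).const_mul (Ω / 2)).mul_const w.im).sub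
      (((hasDerivAt_id (0 : ℝ)).const_add w.re).const_mul (2 * Real.pi * m * n))).congr_deriv ?_
    ring
  have hd2 : HasDerivAt (fun t : ℝ => -(2 * Real.pi * m * (w.re + t))) (-(2 * Real.pi * m)) 0 := by
    refine (((hasDerivAt_id (0 : ℝ)).const_add w.re).const_mul (2 * Real.pi * m)).neg.congr_deriv ?_
    ring
  have he1 := (hd1.ofReal_comp.const_mul Complex.I).cexp
  have he2 := (hd2.ofReal_comp.const_mul Complex.I).cexp
  have hq := he1.mul ((he2.const_mul (s : ℂ)).const_add (c : ℂ))
  simp only [add_zero] at hq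
  rw [← hφ, ← hψ] at hq
  refine ⟨_, hasLineDerivAt_vortex (HasDerivAt.congr_of_eventuallyEq hq
    (Filter.Eventually.of_forall fun t => ?_)), ?_⟩
  · simp [vortexLocal, hc, hs, hn]
  · rw [hv]
    have hfl := Int.floor_le ((m : ℝ) * w.im)
    have hfl' := Int.lt_floor_add_one ((m : ℝ) * w.im)
    rw [← hn] at hfl hfl'
    -- The gauge factor `Ωxy/2` adds to the potential to give `Ωy - 2πmn = (Ω - 2πm²) y + 2πm(my -
    -- n)`: the choice of `m` controls the first summand and the strip the second.
    have heq : Complex.exp (Complex.I * φ) * (Complex.I * (Ω / 2 * w.im - 2 * Real.pi * m * n : ℝ))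
          * (c + s * Complex.exp (Complex.I * ψ))
        + Complex.exp (Complex.I * φ)
          * (s * (Complex.exp (Complex.I * ψ) * (Complex.I * (-(2 * Real.pi * m) : ℝ))))
        + Complex.I * (Ω / 2 * w.im : ℝ)
          * (Complex.exp (Complex.I * φ) * (c + s * Complex.exp (Complex.I * ψ)))
        = Complex.I * (Ω * w.im - 2 * Real.pi * m * n : ℝ) * vortex Ω m w
          + Complex.exp (Complex.I * φ) * Complex.exp (Complex.I * ψ) * Complex.I
            * (-(2 * Real.pi * m) * s : ℝ) := by
      rw [hv]; push_cast; ring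
    rw [heq]
    have hV : ‖vortex Ω m w‖ ≤ 1 := by
      have := (norm_vortex_sq Ω m w).le.trans (latticeSq_le_one m w)
      nlinarith [norm_nonneg (vortex Ω m w)]
    have hm0 : (0 : ℝ) ≤ m := Nat.cast_nonneg m
    have hpi := Real.pi_pos
    have hs1 : |s| ≤ 1 := by
      rw [abs_le]
      constructor <;> linarith [Real.cos_le_one (Real.pi * (m * w.im - n)),
        Real.neg_one_le_cos (Real.pi * (m * w.im - n))]
    have hA : |Ω * w.im - 2 * Real.pi * m * n| ≤ 6 * Real.pi * m := by
      have h1 : Ω * w.im - 2 * Real.pi * m * n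
          = (Ω - 2 * Real.pi * m ^ 2) * w.im + 2 * Real.pi * m * (m * w.im - n) := by ring
      have him : |w.im| ≤ 1 := (Complex.abs_im_le_norm w).trans (norm_lt_one_of_mem hw).le
      have h2 : |m * w.im - n| ≤ 1 := abs_le.2 ⟨by linarith, by linarith⟩
      rw [h1]
      refine (abs_add_le _ _).trans ?_
      rw [abs_mul, abs_mul (2 * Real.pi * m), abs_of_nonneg (by positivity : 0 ≤ 2 * Real.pi * m)]
      have h3 := mul_le_mul hΩ him (abs_nonneg _) (by positivity)
      have h4 := mul_le_mul_of_nonneg_left h2 (by positivity : 0 ≤ 2 * Real.pi * m)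
      linarith
    refine (norm_add_le _ _).trans ?_
    rw [norm_mul, norm_mul, norm_mul, norm_mul, norm_mul, norm_exp_I_mul_ofReal,
      norm_exp_I_mul_ofReal, Complex.norm_I, Complex.norm_real, Complex.norm_real,
      Real.norm_eq_abs, Real.norm_eq_abs, abs_mul (-(2 * Real.pi * m)), abs_neg,
      abs_of_nonneg (by positivity : 0 ≤ 2 * Real.pi * m)]
    have h3 := mul_le_mul hA hV (norm_nonneg _) (by positivity)
    have h4 := mul_le_mul_of_nonneg_left hs1 (by positivity : 0 ≤ 2 * Real.pi * m)
    linarith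

/-- In this direction the gauge factor cancels the potential exactly, so only the derivative of the
interpolation weights remains. -/
lemma exists_covariant_dy_vortex (Ω : ℝ) (m : ℕ) (w : ℂ) :
    ∃ q : ℂ, HasLineDerivAt ℝ (vortex Ω m) q w Complex.I ∧
      ‖q - Complex.I * (Ω / 2 * w.re : ℝ) * vortex Ω m w‖ ≤ Real.pi * m := by
  set n := ⌊m * w.im⌋ with hn
  set φ : ℝ := Ω / 2 * w.re * w.im - 2 * Real.pi * m * n * w.re with hφ
  set T : ℝ := Real.pi * (m * w.im - n) with hT
  set e : ℂ := Complex.exp (Complex.I * (-(2 * Real.pi * m * w.re) : ℝ)) with he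
  have hv : vortex Ω m w = Complex.exp (Complex.I * φ)
    * (((1 + Real.cos T) / 2 : ℝ) + ((1 - Real.cos T) / 2 : ℝ) * e) := rfl
  have hd1 : HasDerivAt (fun t : ℝ => Ω / 2 * w.re * (w.im + t) - 2 * Real.pi * m * n * w.re)
      (Ω / 2 * w.re) 0 := by
    refine ((((hasDerivAt_id (0 : ℝ)).const_add w.im).const_mul (Ω / 2 * w.re)).sub_const
      (2 * Real.pi * m * n * w.re)).congr_deriv ?_
    ring
  have hdT : HasDerivAt (fun t : ℝ => Real.cos (Real.pi * (m * (w.im + t) - n)))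
      (-Real.sin T * (Real.pi * m)) 0 := by
    have := (((((hasDerivAt_id (0 : ℝ)).const_add w.im).const_mul (m : ℝ)).sub_const
      (n : ℝ)).const_mul Real.pi).cos
    simp only [id, add_zero, mul_one] at this
    exact this
  have he1 := (hd1.ofReal_comp.const_mul Complex.I).cexp
  have hc := ((hdT.const_add 1).div_const 2).ofReal_comp
  have hs := ((hdT.const_sub 1).div_const 2).ofReal_comp
  have hq := he1.mul (hc.add (hs.mul_const e))
  simp only [Pi.add_apply, add_zero] at hq
  rw [← hφ, ← hT] at hq
  refine ⟨_, hasLineDerivAt_vortex (HasDerivAt.congr_of_eventuallyEq hq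
    (Filter.Eventually.of_forall fun t => ?_)), ?_⟩
  · simp [vortexLocal, he, hn]
  · rw [hv]
    have heq : Complex.exp (Complex.I * φ) * (Complex.I * (Ω / 2 * w.re : ℝ))
          * (((1 + Real.cos T) / 2 : ℝ) + ((1 - Real.cos T) / 2 : ℝ) * e)
        + Complex.exp (Complex.I * φ) * ((-Real.sin T * (Real.pi * m) / 2 : ℝ)
          + (-(-Real.sin T * (Real.pi * m)) / 2 : ℝ) * e)
        - Complex.I * (Ω / 2 * w.re : ℝ) * (Complex.exp (Complex.I * φ)
          * (((1 + Real.cos T) / 2 : ℝ) + ((1 - Real.cos T) / 2 : ℝ) * e))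
        = Complex.exp (Complex.I * φ) * ((Real.sin T * (Real.pi * m) / 2 : ℝ) * (e - 1)) := by
      push_cast; ring
    refine (congrArg norm heq).trans_le ?_
    have hm0 : (0 : ℝ) ≤ m := Nat.cast_nonneg m
    have hpi := Real.pi_pos
    have h1 : ‖e - 1‖ ≤ 2 := by
      refine (norm_sub_le _ _).trans ?_
      rw [he, norm_exp_I_mul_ofReal, norm_one]; norm_num
    rw [norm_mul, norm_exp_I_mul_ofReal, one_mul, norm_mul, Complex.norm_real, Real.norm_eq_abs,
      abs_div, abs_mul, abs_two, abs_of_nonneg (by positivity : 0 ≤ Real.pi * m)]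
    have h2 := mul_le_mul_of_nonneg_right (Real.abs_sin_le_one T)
      (by positivity : 0 ≤ Real.pi * m)
    have h3 : 0 ≤ |Real.sin T| * (Real.pi * m) := by positivity
    nlinarith [norm_nonneg (e - 1)]

/-! ### The smoothed Thomas-Fermi profile -/

/-- A smooth positive approximation of the positive part. -/
noncomputable def smoothPos (ε t : ℝ) : ℝ := (t + √(t ^ 2 + ε ^ 2)) / 2

lemma abs_lt_sqrt_sq_add {ε : ℝ} (hε : 0 < ε) (t : ℝ) : |t| < √(t ^ 2 + ε ^ 2) :=
  Real.lt_sqrt_of_sq_lt (by rw [sq_abs]; nlinarith)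

lemma smoothPos_pos {ε : ℝ} (hε : 0 < ε) (t : ℝ) : 0 < smoothPos ε t := by
  have := abs_lt_sqrt_sq_add hε t
  have := neg_abs_le t
  unfold smoothPos; linarith

lemma max_zero_le_smoothPos {ε : ℝ} (hε : 0 < ε) (t : ℝ) : max t 0 ≤ smoothPos ε t := by
  have := abs_lt_sqrt_sq_add hε t
  have := le_abs_self t
  exact max_le (by unfold smoothPos; linarith) (smoothPos_pos hε t).le

lemma smoothPos_le {ε : ℝ} (hε : 0 < ε) (t : ℝ) : smoothPos ε t ≤ max t 0 + ε := by
  have h : √(t ^ 2 + ε ^ 2) ≤ |t| + ε := by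
    rw [Real.sqrt_le_left (by positivity)]
    nlinarith [abs_nonneg t, sq_abs t]
  unfold smoothPos
  rcases le_total t 0 with ht | ht
  · rw [abs_of_nonpos ht] at h; rw [max_eq_right ht]; linarith
  · rw [abs_of_nonneg ht] at h; rw [max_eq_left ht]; linarith

lemma hasDerivAt_smoothPos {ε : ℝ} (hε : 0 < ε) {g : ℝ → ℝ} {g' x : ℝ} (hg : HasDerivAt g g' x) :
    HasDerivAt (fun x => smoothPos ε (g x))
      (smoothPos ε (g x) * g' / √(g x ^ 2 + ε ^ 2)) x := by
  have hpos : 0 < g x ^ 2 + ε ^ 2 := by positivity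
  have hs := Real.sqrt_pos.2 hpos
  refine ((hg.add (((hg.pow 2).add_const (ε ^ 2)).sqrt hpos.ne')).div_const 2).congr_deriv ?_
  unfold smoothPos
  simp only [Nat.cast_ofNat, Nat.add_one_sub_one, pow_one, Pi.pow_apply]
  field_simp
  ring

/-- With `R = √(t² + ε²)` the logarithmic derivative of `smoothPos` is exactly `t'/R`, so the
quotient is `t'² smoothPos / R²`; then `smoothPos ≤ R` and `ε ≤ R`. It bounds the gradient energy of
the square root of the density. -/
lemma smoothPos_deriv_sq_div_le {ε : ℝ} (hε : 0 < ε) (t t' : ℝ) :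
    (smoothPos ε t * t' / √(t ^ 2 + ε ^ 2)) ^ 2 / smoothPos ε t ≤ t' ^ 2 / ε := by
  have hs := smoothPos_pos hε t
  have hR := abs_lt_sqrt_sq_add hε t
  have hR0 : 0 < √(t ^ 2 + ε ^ 2) := (abs_nonneg t).trans_lt hR
  have hRε : ε ≤ √(t ^ 2 + ε ^ 2) := Real.le_sqrt_of_sq_le (by nlinarith)
  have hsR : smoothPos ε t ≤ √(t ^ 2 + ε ^ 2) := by
    have := le_abs_self t
    unfold smoothPos; linarith
  have h1 : (smoothPos ε t * t' / √(t ^ 2 + ε ^ 2)) ^ 2 / smoothPos ε t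
      = t' ^ 2 * (smoothPos ε t / √(t ^ 2 + ε ^ 2) ^ 2) := by
    field_simp
  rw [h1, div_eq_mul_one_div (t' ^ 2) ε]
  refine mul_le_mul_of_nonneg_left ?_ (sq_nonneg _)
  rw [div_le_div_iff₀ (by positivity) hε]
  nlinarith

/-- The smoothed Thomas-Fermi density. -/
noncomputable def smoothDensity (Ω₀ μ ε : ℝ) (z : ℂ) : ℝ :=
  smoothPos ε (μ + Ω₀ ^ 2 / 8 * ‖z‖ ^ 2)

lemma continuous_smoothDensity (Ω₀ μ ε : ℝ) : Continuous (smoothDensity Ω₀ μ ε) := by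
  unfold smoothDensity smoothPos; fun_prop

lemma hasLineDerivAt_potential (Ω₀ μ : ℝ) (z v : ℂ) :
    HasLineDerivAt ℝ (fun z : ℂ => μ + Ω₀ ^ 2 / 8 * ‖z‖ ^ 2) (Ω₀ ^ 2 / 8 * (2 * inner ℝ z v)) z v := by
  have h := (((hasStrictFDerivAt_norm_sq z).hasFDerivAt.const_mul (Ω₀ ^ 2 / 8)).const_add
    μ).hasLineDerivAt v
  refine HasDerivAt.congr_deriv h ?_
  simp only [smul_apply, innerSL_apply_apply, smul_eq_mul, nsmul_eq_mul]
  norm_num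

lemma exists_hasLineDerivAt_smoothDensity (Ω₀ μ : ℝ) {ε : ℝ} (hε : 0 < ε) {z v : ℂ}
    (hz : z ∈ unitDisc) (hv : ‖v‖ = 1) :
    ∃ s' : ℝ, HasLineDerivAt ℝ (smoothDensity Ω₀ μ ε) s' z v ∧
      s' ^ 2 / smoothDensity Ω₀ μ ε z ≤ Ω₀ ^ 4 / 16 / ε := by
  have h := hasDerivAt_smoothPos hε (hasLineDerivAt_potential Ω₀ μ z v)
  simp only [zero_smul, add_zero] at h
  refine ⟨_, h, (smoothPos_deriv_sq_div_le hε _ _).trans ?_⟩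
  have hi : inner ℝ z v ^ 2 ≤ 1 := by
    have h1 := abs_real_inner_le_norm z v
    rw [hv, mul_one] at h1
    exact (sq_le_one_iff_abs_le_one _).2 (h1.trans (norm_lt_one_of_mem hz).le)
  gcongr
  nlinarith [mul_nonneg (sq_nonneg (Ω₀ ^ 2)) (sub_nonneg.2 hi)]

/-! ### The trial function -/

lemma differentiable_latticeSq (m : ℕ) : Differentiable ℝ (latticeSq m) := by
  have hre := differentiable_re
  have him := differentiable_im
  unfold latticeSq
  fun_prop

/-- The derivative carries a factor `cos(πmx)`, whose square is at most `latticeSq`. It says that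
`√latticeSq` has slope at most `πm`, even near its zeros. -/
lemma exists_hasLineDerivAt_latticeSq_one (m : ℕ) (z : ℂ) :
    ∃ V' : ℝ, HasLineDerivAt ℝ (latticeSq m) V' z 1 ∧
      V' ^ 2 ≤ (2 * Real.pi * m) ^ 2 * latticeSq m z := by
  set X := Real.pi * (m * z.re) with hX
  set Y := Real.pi * (m * z.im) with hY
  have hd : HasDerivAt (fun t : ℝ => 1 - Real.sin (Real.pi * (m * (z.re + t))) ^ 2
      * Real.sin Y ^ 2) (-(2 * Real.sin X * (Real.cos X * (Real.pi * m)) * Real.sin Y ^ 2)) 0 := by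
    have := ((((((hasDerivAt_id (0 : ℝ)).const_add z.re).const_mul (m : ℝ)).const_mul
      Real.pi).sin.pow 2).mul_const (Real.sin Y ^ 2)).const_sub 1
    simpa using this
  refine ⟨_, hd.congr_of_eventuallyEq (Filter.Eventually.of_forall fun t => ?_), ?_⟩
  · simp [latticeSq, hY]
  · have h1 := (cos_sq_le_latticeSq m z).1
    rw [← hX] at h1
    have h2 : Real.sin X ^ 2 ≤ 1 := Real.sin_sq_le_one X
    have h3 : (Real.sin Y ^ 2) ^ 2 ≤ 1 := pow_le_one₀ (sq_nonneg _) (Real.sin_sq_le_one Y)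
    calc _ = (2 * Real.pi * m) ^ 2 * (Real.cos X ^ 2 * (Real.sin X ^ 2 * (Real.sin Y ^ 2) ^ 2)) := by
          ring
      _ ≤ (2 * Real.pi * m) ^ 2 * (latticeSq m z * (1 * 1)) := by
          gcongr
          exact (sq_nonneg _).trans h1
      _ = _ := by ring

lemma exists_hasLineDerivAt_latticeSq_I (m : ℕ) (z : ℂ) :
    ∃ V' : ℝ, HasLineDerivAt ℝ (latticeSq m) V' z Complex.I ∧
      V' ^ 2 ≤ (2 * Real.pi * m) ^ 2 * latticeSq m z := by
  set X := Real.pi * (m * z.re) with hX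
  set Y := Real.pi * (m * z.im) with hY
  have hd : HasDerivAt (fun t : ℝ => 1 - Real.sin X ^ 2
      * Real.sin (Real.pi * (m * (z.im + t))) ^ 2)
      (-(Real.sin X ^ 2 * (2 * Real.sin Y * (Real.cos Y * (Real.pi * m))))) 0 := by
    have := ((((((hasDerivAt_id (0 : ℝ)).const_add z.im).const_mul (m : ℝ)).const_mul
      Real.pi).sin.pow 2).const_mul (Real.sin X ^ 2)).const_sub 1
    simpa using this
  refine ⟨_, hd.congr_of_eventuallyEq (Filter.Eventually.of_forall fun t => ?_), ?_⟩
  · simp [latticeSq, hX]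
  · have h1 := (cos_sq_le_latticeSq m z).2
    rw [← hY] at h1
    have h2 : Real.sin Y ^ 2 ≤ 1 := Real.sin_sq_le_one Y
    have h3 : (Real.sin X ^ 2) ^ 2 ≤ 1 := pow_le_one₀ (sq_nonneg _) (Real.sin_sq_le_one X)
    calc _ = (2 * Real.pi * m) ^ 2 * (Real.cos Y ^ 2 * (Real.sin Y ^ 2 * (Real.sin X ^ 2) ^ 2)) := by
          ring
      _ ≤ (2 * Real.pi * m) ^ 2 * (latticeSq m z * (1 * 1)) := by
          gcongr
          exact (sq_nonneg _).trans h1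
      _ = _ := by ring

/-- The smoothed density divided by the regularized squared modulus of the vortex lattice. -/
noncomputable def amplitudeSq (Ω₀ μ ε : ℝ) (m : ℕ) (z : ℂ) : ℝ :=
  smoothDensity Ω₀ μ ε z / (latticeSq m z + ε)

/-- The trial function with normalization constant `c`. -/
noncomputable def trial (Ω₀ μ ε Ω : ℝ) (m : ℕ) (c : ℝ) (z : ℂ) : ℂ :=
  (c * √(amplitudeSq Ω₀ μ ε m z) : ℝ) * vortex Ω m z

section trial

variable {Ω₀ μ ε Ω : ℝ} {m : ℕ}

lemma latticeSq_add_pos (hε : 0 < ε) (m : ℕ) (z : ℂ) : 0 < latticeSq m z + ε :=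
  add_pos_of_nonneg_of_pos (latticeSq_nonneg m z) hε

lemma amplitudeSq_pos (hε : 0 < ε) (z : ℂ) : 0 < amplitudeSq Ω₀ μ ε m z :=
  div_pos (smoothPos_pos hε _) (latticeSq_add_pos hε m z)

lemma norm_trial_sq (hε : 0 < ε) (c : ℝ) (z : ℂ) :
    ‖trial Ω₀ μ ε Ω m c z‖ ^ 2 = c ^ 2 * (amplitudeSq Ω₀ μ ε m z * latticeSq m z) := by
  rw [trial, norm_mul, mul_pow, norm_vortex_sq, Complex.norm_real, Real.norm_eq_abs, sq_abs,
    mul_pow, Real.sq_sqrt (amplitudeSq_pos hε z).le]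
  ring

lemma differentiable_smoothDensity (hε : 0 < ε) : Differentiable ℝ (smoothDensity Ω₀ μ ε) := by
  have h : Differentiable ℝ fun z : ℂ => ‖z‖ ^ 2 := fun z =>
    (hasStrictFDerivAt_norm_sq z).differentiableAt
  unfold smoothDensity smoothPos
  have h2 : Differentiable ℝ fun z : ℂ => μ + Ω₀ ^ 2 / 8 * ‖z‖ ^ 2 :=
    (h.const_mul _).const_add _
  have h3 : Differentiable ℝ fun z : ℂ => √((μ + Ω₀ ^ 2 / 8 * ‖z‖ ^ 2) ^ 2 + ε ^ 2) :=
    ((h2.fun_pow 2).add_const (ε ^ 2)).sqrt fun z => by positivity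
  simp only [div_eq_mul_inv _ (2 : ℝ)]
  exact (h2.add h3).mul_const _

lemma differentiable_trial (hε : 0 < ε) (c : ℝ) : Differentiable ℝ (trial Ω₀ μ ε Ω m c) := by
  have h1 : Differentiable ℝ (amplitudeSq Ω₀ μ ε m) := by
    unfold amplitudeSq
    simp only [div_eq_mul_inv]
    exact (differentiable_smoothDensity hε).mul (((differentiable_latticeSq m).add_const ε).inv
      fun z => (latticeSq_add_pos hε m z).ne')
  have h2 : Differentiable ℝ fun z => c * √(amplitudeSq Ω₀ μ ε m z) :=
    (h1.sqrt fun z => (amplitudeSq_pos hε z).ne').const_mul c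
  exact (Complex.ofRealCLM.differentiable.comp h2).mul
    fun z => (hasFDerivAt_vortex Ω m z).differentiableAt

lemma continuous_amplitudeSq (hε : 0 < ε) : Continuous (amplitudeSq Ω₀ μ ε m) :=
  (continuous_smoothDensity Ω₀ μ ε).div ((continuous_latticeSq m).add continuous_const)
    fun z => (latticeSq_add_pos hε m z).ne'

/-- The modulus gradient of `√(s / (V + ε)) v`, `|v|² = V`. -/
lemma amplitude_gradient_bound {s s' V V' L : ℝ} (hε : 0 < ε) (hs : 0 < s) (hV : 0 ≤ V)
    (hV' : V' ^ 2 ≤ L * V) (hL : 0 ≤ L) :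
    ((s' * (V + ε) - s * V') / (V + ε) ^ 2 / (2 * √(s / (V + ε)))) ^ 2 * V
      ≤ s' ^ 2 / s / 2 + L / 2 * (s / (V + ε)) := by
  have hW : 0 < V + ε := by positivity
  have hg : 0 < s / (V + ε) := by positivity
  have hVW : V / (V + ε) ≤ 1 := (div_le_one hW).2 (by linarith)
  have hVW0 : 0 ≤ V / (V + ε) := by positivity
  have e1 : ((s' * (V + ε) - s * V') / (V + ε) ^ 2 / (2 * √(s / (V + ε)))) ^ 2 * V
      = s / 4 * (V / (V + ε)) * (s' / s - V' / (V + ε)) ^ 2 := by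
    rw [div_pow _ (2 * _), mul_pow, Real.sq_sqrt hg.le]
    field_simp
    ring
  have e2 : (s' / s - V' / (V + ε)) ^ 2 ≤ 2 * (s' / s) ^ 2 + 2 * (V' / (V + ε)) ^ 2 := by
    nlinarith [sq_nonneg (s' / s + V' / (V + ε))]
  -- The factor `V` gained from `V'² ≤ L V` reduces the core singularity from `(V + ε)⁻²` to `(V +
  -- ε)⁻¹`, which integrates to a logarithm.
  have e3 : (V' / (V + ε)) ^ 2 ≤ L * (V / (V + ε)) / (V + ε) := by
    rw [div_pow, ← mul_div_assoc, div_div, ← sq]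
    gcongr
  have e4 : L * (V / (V + ε)) / (V + ε) ≤ L * 1 / (V + ε) := by gcongr
  rw [e1]
  calc s / 4 * (V / (V + ε)) * (s' / s - V' / (V + ε)) ^ 2
      ≤ s / 4 * 1 * (2 * (s' / s) ^ 2 + 2 * (L * 1 / (V + ε))) := by
        have := e3.trans e4
        gcongr
        linarith
    _ = _ := by field_simp; ring

lemma covariant_trial_bound (hε : 0 < ε) (c : ℝ) {z v A q : ℂ} {V' : ℝ} (hz : z ∈ unitDisc)
    (hv : ‖v‖ = 1) (hV : HasLineDerivAt ℝ (latticeSq m) V' z v)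
    (hV' : V' ^ 2 ≤ (2 * Real.pi * m) ^ 2 * latticeSq m z)
    (hq : HasLineDerivAt ℝ (vortex Ω m) q z v) (hq' : ‖q + A * vortex Ω m z‖ ≤ 8 * Real.pi * m) :
    ‖fderiv ℝ (trial Ω₀ μ ε Ω m c) z v + A * trial Ω₀ μ ε Ω m c z‖ ^ 2
      ≤ c ^ 2 * (Ω₀ ^ 4 / 16 / ε + 132 * (Real.pi * m) ^ 2 * amplitudeSq Ω₀ μ ε m z) := by
  obtain ⟨s', hs', hsb⟩ := exists_hasLineDerivAt_smoothDensity Ω₀ μ hε hz hv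
  have hs : 0 < smoothDensity Ω₀ μ ε z := smoothPos_pos hε _
  have hV0 := latticeSq_nonneg m z
  have hg := amplitudeSq_pos (Ω₀ := Ω₀) (μ := μ) (m := m) hε z
  have hW := latticeSq_add_pos hε m z
  unfold HasLineDerivAt at hs' hV hq
  have hgd := hs'.div (hV.add_const ε) (by simpa using hW.ne')
  have hFd := (hgd.sqrt (by simpa [amplitudeSq] using hg.ne')).const_mul c
  have hd := hFd.ofReal_comp.mul hq
  simp only [Pi.div_apply, zero_smul, add_zero] at hd
  set F' := (s' * (latticeSq m z + ε) - smoothDensity Ω₀ μ ε z * V') / (latticeSq m z + ε) ^ 2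
    / (2 * √(smoothDensity Ω₀ μ ε z / (latticeSq m z + ε))) with hF'
  have hfd := (differentiable_trial (Ω₀ := Ω₀) (μ := μ) (Ω := Ω) (m := m) hε c
    z).hasFDerivAt.hasLineDerivAt v
  have heq : fderiv ℝ (trial Ω₀ μ ε Ω m c) z v
      = ((c * F' : ℝ) : ℂ) * vortex Ω m z + ((c * √(amplitudeSq Ω₀ μ ε m z) : ℝ) : ℂ) * q :=
    HasDerivAt.unique hfd hd
  -- The amplitude is real, so the potential acts on the vortex factor alone.
  have hsum : fderiv ℝ (trial Ω₀ μ ε Ω m c) z v + A * trial Ω₀ μ ε Ω m c z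
      = ((c * F' : ℝ) : ℂ) * vortex Ω m z
        + ((c * √(amplitudeSq Ω₀ μ ε m z) : ℝ) : ℂ) * (q + A * vortex Ω m z) := by
    rw [heq, trial]; ring
  have hb := amplitude_gradient_bound hε hs hV0 (s' := s') hV' (by positivity)
  rw [← hF'] at hb
  have h1 : ‖((c * F' : ℝ) : ℂ) * vortex Ω m z‖ ^ 2 = c ^ 2 * (F' ^ 2 * latticeSq m z) := by
    rw [norm_mul, mul_pow, norm_vortex_sq, Complex.norm_real, Real.norm_eq_abs, sq_abs]
    ring
  have h2 : ‖((c * √(amplitudeSq Ω₀ μ ε m z) : ℝ) : ℂ) * (q + A * vortex Ω m z)‖ ^ 2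
      ≤ c ^ 2 * (amplitudeSq Ω₀ μ ε m z * (8 * Real.pi * m) ^ 2) := by
    rw [norm_mul, mul_pow, Complex.norm_real, Real.norm_eq_abs, sq_abs, mul_pow,
      Real.sq_sqrt hg.le, mul_assoc]
    gcongr
  rw [hsum]
  calc _ ≤ (‖((c * F' : ℝ) : ℂ) * vortex Ω m z‖
        + ‖((c * √(amplitudeSq Ω₀ μ ε m z) : ℝ) : ℂ) * (q + A * vortex Ω m z)‖) ^ 2 := by
        gcongr; exact norm_add_le _ _
    _ ≤ 2 * (‖((c * F' : ℝ) : ℂ) * vortex Ω m z‖ ^ 2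
        + ‖((c * √(amplitudeSq Ω₀ μ ε m z) : ℝ) : ℂ) * (q + A * vortex Ω m z)‖ ^ 2) := add_sq_le
    _ ≤ 2 * (c ^ 2 * (Ω₀ ^ 4 / 16 / ε / 2 + (2 * Real.pi * m) ^ 2 / 2 * amplitudeSq Ω₀ μ ε m z)
        + c ^ 2 * (amplitudeSq Ω₀ μ ε m z * (8 * Real.pi * m) ^ 2)) := by
        rw [h1]
        gcongr
        refine hb.trans ?_
        gcongr
        exact le_rfl
    -- `132 = 2 (2² / 2 + 8²)`.
    _ = c ^ 2 * (Ω₀ ^ 4 / 16 / ε + 132 * (Real.pi * m) ^ 2 * amplitudeSq Ω₀ μ ε m z) := by ring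

lemma magneticDensity_trial_le (hε : 0 < ε) (c : ℝ)
    (hΩ : |Ω - 2 * Real.pi * m ^ 2| ≤ 4 * Real.pi * m) {z : ℂ} (hz : z ∈ unitDisc) :
    magneticDensity Ω z (trial Ω₀ μ ε Ω m c z) (fderiv ℝ (trial Ω₀ μ ε Ω m c) z 1)
        (fderiv ℝ (trial Ω₀ μ ε Ω m c) z Complex.I)
      ≤ c ^ 2 * (Ω₀ ^ 4 / 8 / ε + 264 * (Real.pi * m) ^ 2 * amplitudeSq Ω₀ μ ε m z) := by
  obtain ⟨V₁, hV₁, hV₁'⟩ := exists_hasLineDerivAt_latticeSq_one m z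
  obtain ⟨V₂, hV₂, hV₂'⟩ := exists_hasLineDerivAt_latticeSq_I m z
  obtain ⟨q₁, hq₁, hq₁'⟩ := exists_covariant_dx_vortex hz hΩ
  obtain ⟨q₂, hq₂, hq₂'⟩ := exists_covariant_dy_vortex Ω m z
  have h1 := covariant_trial_bound (Ω₀ := Ω₀) (μ := μ) hε c hz norm_one hV₁ hV₁' hq₁ hq₁'
  rw [sub_eq_add_neg, ← neg_mul] at hq₂'
  have h2 := covariant_trial_bound (Ω₀ := Ω₀) (μ := μ) hε c hz Complex.norm_I hV₂ hV₂' hq₂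
    (hq₂'.trans (by nlinarith [mul_nonneg Real.pi_pos.le (Nat.cast_nonneg m : (0 : ℝ) ≤ m)]))
  rw [neg_mul, ← sub_eq_add_neg] at h2
  unfold magneticDensity
  refine (add_le_add h1 h2).trans_eq ?_
  ring

end trial

/-! ### Stability of the Thomas-Fermi functional -/

/-- The Thomas-Fermi energy of the normalization of a density `L¹`-close to a normalized one. -/
lemma tfFunctional_normalize_le (Ω₀ : ℝ) {f ρ : ℂ → ℝ} {K η : ℝ} (hf : Continuous f)
    (hρ : Continuous ρ) (hK : 1 ≤ K) (hf0 : ∀ z, 0 ≤ f z) (hρ0 : ∀ z, 0 ≤ ρ z)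
    (hfK : ∀ z ∈ unitDisc, f z ≤ K) (hρK : ∀ z ∈ unitDisc, ρ z ≤ K)
    (hρ1 : ∫ z, ρ z ∂discMeasure = 1) (hη : ∫ z, |f z - ρ z| ∂discMeasure ≤ η) (hη2 : η ≤ 1 / 2) :
    1 / 2 ≤ ∫ z, f z ∂discMeasure ∧
      tfFunctional Ω₀ (fun z => (∫ z, f z ∂discMeasure)⁻¹ * f z)
        ≤ tfFunctional Ω₀ ρ + (14 * K + 5 * (Ω₀ ^ 2 / 4)) * η := by
  have hd : Integrable (fun z => |f z - ρ z|) discMeasure := (hf.sub hρ).abs.integrable_disc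
  have hη0 : 0 ≤ η := (integral_nonneg fun z => abs_nonneg _).trans hη
  have hfi := hf.integrable_disc
  have hρi := hρ.integrable_disc
  have hn : ∀ z ∈ unitDisc, ‖z‖ ^ 2 ≤ 1 := fun z hz =>
    pow_le_one₀ (norm_nonneg z) (norm_lt_one_of_mem hz).le
  have hnf : Continuous fun z : ℂ => ‖z‖ ^ 2 * f z := by fun_prop
  have hnρ : Continuous fun z : ℂ => ‖z‖ ^ 2 * ρ z := by fun_prop
  have hM1 : ∫ z, f z ∂discMeasure ≤ 1 + η := by
    have := integral_disc_mono hfi (hρi.add hd) fun z _ => by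
      simp only [Pi.add_apply]; linarith [le_abs_self (f z - ρ z)]
    simp only [Pi.add_apply] at this
    rw [integral_add hρi hd] at this
    linarith
  have hM2 : 1 - η ≤ ∫ z, f z ∂discMeasure := by
    have := integral_disc_mono (hρi.sub hd) hfi fun z _ => by
      simp only [Pi.sub_apply]; linarith [neg_abs_le (f z - ρ z)]
    simp only [Pi.sub_apply] at this
    rw [integral_sub hρi hd] at this
    linarith
  have hQ : ∫ z, f z ^ 2 ∂discMeasure ≤ ∫ z, ρ z ^ 2 ∂discMeasure + 2 * K * η := by
    have := integral_disc_mono (hf.pow 2).integrable_disc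
      ((hρ.pow 2).integrable_disc.add (hd.const_mul (2 * K))) fun z hz => by
        simp only [Pi.add_apply, Pi.pow_apply]
        have h1 : f z ^ 2 - ρ z ^ 2 ≤ |f z - ρ z| * (f z + ρ z) := by
          have := le_abs_self (f z - ρ z)
          nlinarith [hf0 z, hρ0 z]
        have h2 : |f z - ρ z| * (f z + ρ z) ≤ |f z - ρ z| * (2 * K) :=
          mul_le_mul_of_nonneg_left (by linarith [hfK z hz, hρK z hz]) (abs_nonneg _)
        linarith
    simp only [Pi.add_apply, Pi.pow_apply] at this
    have hρ2 : Integrable (fun z => ρ z ^ 2) discMeasure := (hρ.pow 2).integrable_disc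
    rw [integral_add hρ2 (hd.const_mul _), integral_const_mul] at this
    have h3 := mul_le_mul_of_nonneg_left hη (by positivity : 0 ≤ 2 * K)
    linarith
  have hQK : ∫ z, ρ z ^ 2 ∂discMeasure ≤ K := by
    have := integral_disc_mono (hρ.pow 2).integrable_disc (hρi.const_mul K) fun z hz => by
      simp only [Pi.pow_apply]; nlinarith [hρ0 z, hρK z hz]
    rwa [integral_const_mul, hρ1, mul_one] at this
  have hP : ∫ z, ‖z‖ ^ 2 * ρ z ∂discMeasure - η ≤ ∫ z, ‖z‖ ^ 2 * f z ∂discMeasure := by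
    have := integral_disc_mono (hnρ.integrable_disc.sub hd) hnf.integrable_disc fun z hz => by
      simp only [Pi.sub_apply]
      have h1 := neg_abs_le (f z - ρ z)
      have h2 := hn z hz
      nlinarith [abs_nonneg (f z - ρ z), sq_nonneg ‖z‖]
    simp only [Pi.sub_apply] at this
    rw [integral_sub hnρ.integrable_disc hd] at this
    linarith
  have hPf : ∫ z, ‖z‖ ^ 2 * f z ∂discMeasure ≤ 2 := by
    have := integral_disc_mono hnf.integrable_disc hfi fun z hz => by
      nlinarith [hn z hz, hf0 z]
    linarith
  have hPf0 : 0 ≤ ∫ z, ‖z‖ ^ 2 * f z ∂discMeasure :=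
    integral_nonneg fun z => mul_nonneg (sq_nonneg _) (hf0 z)
  have hQ0 : 0 ≤ ∫ z, f z ^ 2 ∂discMeasure := integral_nonneg fun z => sq_nonneg _
  refine ⟨by linarith, ?_⟩
  rw [tfFunctional_eq Ω₀ hρ.memLp_disc, tfFunctional_eq Ω₀ (hf.const_mul _).memLp_disc]
  set M := ∫ z, f z ∂discMeasure
  have e1 : ∫ z, (M⁻¹ * f z) ^ 2 ∂discMeasure = M⁻¹ ^ 2 * ∫ z, f z ^ 2 ∂discMeasure := by
    rw [← integral_const_mul]; congr 1 with z; ring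
  have e2 : ∫ z, ‖z‖ ^ 2 * (M⁻¹ * f z) ∂discMeasure
      = M⁻¹ * ∫ z, ‖z‖ ^ 2 * f z ∂discMeasure := by
    rw [← integral_const_mul]; congr 1 with z; ring
  rw [e1, e2]
  have hMpos : 0 < M := by linarith
  -- `1 ≤ (1 + 2η)(1 - η)` because `η ≤ 1/2`.
  have hu1 : M⁻¹ ≤ 1 + 2 * η := by
    rw [inv_le_comm₀ hMpos (by linarith)]
    refine le_trans ?_ hM2
    rw [inv_le_iff_one_le_mul₀ (by linarith)]
    nlinarith
  have hu2 : 1 - 2 * η ≤ M⁻¹ := by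
    rw [← one_div, le_div_iff₀ hMpos]
    nlinarith
  have hu3 : M⁻¹ ^ 2 ≤ 1 + 6 * η := by
    have : M⁻¹ ^ 2 ≤ (1 + 2 * η) ^ 2 := pow_le_pow_left₀ (by positivity) hu1 2
    nlinarith
  -- `14 = 2 + 6 · 2`: the change of `∫ f²` plus the normalization error times `∫ f² ≤ 2K`. Likewise
  -- `5 = 1 + 2 · 2` in `t2`.
  have t1 : M⁻¹ ^ 2 * ∫ z, f z ^ 2 ∂discMeasure ≤ ∫ z, ρ z ^ 2 ∂discMeasure + 14 * K * η := by
    have h1 := mul_le_mul_of_nonneg_right hu3 hQ0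
    have h2 : ∫ z, f z ^ 2 ∂discMeasure ≤ 2 * K := by nlinarith
    have h3 := mul_le_mul_of_nonneg_left h2 (by positivity : 0 ≤ 6 * η)
    linarith
  have t2 : ∫ z, ‖z‖ ^ 2 * ρ z ∂discMeasure - 5 * η
      ≤ M⁻¹ * ∫ z, ‖z‖ ^ 2 * f z ∂discMeasure := by
    have h1 := mul_le_mul_of_nonneg_right hu2 hPf0
    have h3 := mul_le_mul_of_nonneg_left hPf (by positivity : 0 ≤ 2 * η)
    linarith
  have t3 := mul_le_mul_of_nonneg_left t2 (by positivity : 0 ≤ Ω₀ ^ 2 / 4)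
  linarith

/-! ### The upper bound -/

/-- The number of vortices per unit length matching the angular velocity. -/
lemma exists_lattice_constant {Ω : ℝ} (hΩ : 0 < Ω) :
    ∃ m : ℕ, m ≠ 0 ∧ |Ω - 2 * Real.pi * m ^ 2| ≤ 4 * Real.pi * m ∧ (m : ℝ) ^ 2 ≤ Ω + 2 := by
  have hpi := Real.pi_gt_three
  set x := √(Ω / (2 * Real.pi)) with hx
  have hx0 : 0 < x := Real.sqrt_pos.2 (by positivity)
  have hx2 : 2 * Real.pi * x ^ 2 = Ω := by
    rw [hx, Real.sq_sqrt (by positivity)]; field_simp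
  have h1 : x ≤ ⌈x⌉₊ := Nat.le_ceil x
  have h2 : (⌈x⌉₊ : ℝ) < x + 1 := Nat.ceil_lt_add_one hx0.le
  -- Rounding `x = √(Ω/2π)` up keeps `m` nonzero; then `m² - x² ≤ 2m`, and `m² ≤ (x + 1)² ≤ 2x² + 2
  -- ≤ Ω + 2`.
  refine ⟨⌈x⌉₊, (Nat.ceil_pos.2 hx0).ne', ?_, ?_⟩
  · set k : ℝ := (⌈x⌉₊ : ℝ)
    have h3 : k ^ 2 - x ^ 2 ≤ 2 * k := by nlinarith
    have h4 : x ^ 2 ≤ k ^ 2 := pow_le_pow_left₀ hx0.le h1 2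
    rw [← hx2, ← mul_sub, abs_mul, abs_of_pos (by positivity), abs_sub_comm,
      abs_of_nonneg (by linarith)]
    nlinarith
  · nlinarith [sq_nonneg (x - 1), sq_nonneg x]

/-- A bound on the densities in terms of the chemical potential. -/
noncomputable def densityBound (Ω₀ μ : ℝ) : ℝ := |μ| + Ω₀ ^ 2 / 8 + 1

lemma one_le_densityBound (Ω₀ μ : ℝ) : 1 ≤ densityBound Ω₀ μ := by
  unfold densityBound
  have := abs_nonneg μ
  have : 0 ≤ Ω₀ ^ 2 / 8 := by positivity
  linarith

lemma tfDensity_add_one_le (Ω₀ μ : ℝ) {z : ℂ} (hz : z ∈ unitDisc) :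
    tfDensity Ω₀ μ z + 1 ≤ densityBound Ω₀ μ := by
  have h1 : ‖z‖ ^ 2 ≤ 1 := pow_le_one₀ (norm_nonneg z) (norm_lt_one_of_mem hz).le
  have h2 := mul_le_mul_of_nonneg_left h1 (by positivity : 0 ≤ Ω₀ ^ 2 / 8)
  have h3 := le_abs_self μ
  have h4 : tfDensity Ω₀ μ z ≤ |μ| + Ω₀ ^ 2 / 8 := max_le (by linarith) (by positivity)
  unfold densityBound
  linarith

section upper

variable {Ω₀ μ ε : ℝ} {m : ℕ}

lemma smoothDensity_le (hε : 0 < ε) (hε4 : ε ≤ 1 / 4) {z : ℂ} (hz : z ∈ unitDisc) :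
    smoothDensity Ω₀ μ ε z ≤ densityBound Ω₀ μ :=
  (smoothPos_le hε _).trans ((add_le_add_right (by linarith) _).trans
    (tfDensity_add_one_le Ω₀ μ hz))

lemma amplitudeSq_le (hε : 0 < ε) (hε4 : ε ≤ 1 / 4) {z : ℂ} (hz : z ∈ unitDisc) :
    amplitudeSq Ω₀ μ ε m z ≤ densityBound Ω₀ μ * (1 / (latticeSq m z + ε)) := by
  rw [mul_one_div, amplitudeSq]
  have := latticeSq_add_pos hε m z
  gcongr
  exact smoothDensity_le hε hε4 hz

/-- `amplitudeSq · latticeSq = smoothDensity - ε · amplitudeSq`; the smoothing costs at most `ε`,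
and the regularization at the cores costs the second term. -/
lemma abs_density_sub_le (hε : 0 < ε) (hε4 : ε ≤ 1 / 4) {z : ℂ} (hz : z ∈ unitDisc) :
    |amplitudeSq Ω₀ μ ε m z * latticeSq m z - tfDensity Ω₀ μ z|
      ≤ ε + ε * densityBound Ω₀ μ * (1 / (latticeSq m z + ε)) := by
  have hW := latticeSq_add_pos hε m z
  have h1 : amplitudeSq Ω₀ μ ε m z * latticeSq m z
      = smoothDensity Ω₀ μ ε z - ε * amplitudeSq Ω₀ μ ε m z := by
    unfold amplitudeSq; field_simp; ring
  have h2 := amplitudeSq_le (Ω₀ := Ω₀) (μ := μ) (m := m) hε hε4 hz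
  have h3 := mul_le_mul_of_nonneg_left h2 hε.le
  have h4 : tfDensity Ω₀ μ z ≤ smoothDensity Ω₀ μ ε z := max_zero_le_smoothPos hε _
  have h5 : smoothDensity Ω₀ μ ε z ≤ tfDensity Ω₀ μ z + ε := smoothPos_le hε _
  have h6 := mul_pos hε (amplitudeSq_pos (Ω₀ := Ω₀) (μ := μ) (m := m) hε z)
  rw [h1, abs_le]
  constructor <;> linarith

lemma le_mul_abs_log (hε : 0 < ε) (hε4 : ε ≤ 1 / 4) : ε ≤ ε * |Real.log ε| :=
  le_mul_of_one_le_right hε.le (one_le_abs_log hε hε4)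

lemma integral_abs_density_sub_le (hε : 0 < ε) (hε4 : ε ≤ 1 / 4) (hm : m ≠ 0) :
    ∫ z, |amplitudeSq Ω₀ μ ε m z * latticeSq m z - tfDensity Ω₀ μ z| ∂discMeasure
      ≤ (4 + 24 * densityBound Ω₀ μ) * (ε * |Real.log ε|) := by
  have hi := (continuous_inv_latticeSq_add m hε).integrable_disc
  have hc : Continuous fun z =>
      |amplitudeSq Ω₀ μ ε m z * latticeSq m z - tfDensity Ω₀ μ z| :=
    (((continuous_amplitudeSq hε).mul (continuous_latticeSq m)).sub
      (continuous_tfDensity Ω₀ μ)).abs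
  have h := integral_disc_mono hc.integrable_disc
    ((integrable_const ε).add (hi.const_mul (ε * densityBound Ω₀ μ)))
    fun z hz => abs_density_sub_le hε hε4 hz
  simp only [Pi.add_apply] at h
  rw [integral_add (integrable_const ε) (hi.const_mul _), integral_const_mul, integral_const,
    discMeasure_real_univ, smul_eq_mul] at h
  have hK := one_le_densityBound Ω₀ μ
  have h2 := mul_le_mul_of_nonneg_left (integral_inv_latticeSq_le hm hε hε4)
    (by positivity : 0 ≤ ε * densityBound Ω₀ μ)
  have h3 := mul_le_mul_of_nonneg_right Real.pi_le_four hε.le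
  have h4 := le_mul_abs_log hε hε4
  linarith

/-- The constant in the upper bound. -/
noncomputable def upperConst (Ω₀ μ : ℝ) : ℝ :=
  (14 * densityBound Ω₀ μ + 5 * (Ω₀ ^ 2 / 4)) * (4 + 24 * densityBound Ω₀ μ)
    + (Ω₀ ^ 4 + 202752 * densityBound Ω₀ μ * (Ω₀ + 1))

lemma exists_trial_energy (hΩ₀ : 0 < Ω₀) (hμ : ∫ z, tfDensity Ω₀ μ z ∂discMeasure = 1)
    (hε : 0 < ε) (hε4 : ε ≤ 1 / 4)
    (hsmall : (4 + 24 * densityBound Ω₀ μ) * (ε * |Real.log ε|) ≤ 1 / 2) :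
    ∃ Ψ : H1Disc, ∫ z, ‖Ψ.toFun z‖ ^ 2 ∂discMeasure = 1 ∧ ∃ E : ℝ,
      gpFunctional (Ω₀ / ε) ε Ψ = (E : EReal) ∧
      ε ^ 2 * E ≤ tfFunctional Ω₀ (tfDensity Ω₀ μ) + upperConst Ω₀ μ * (ε * |Real.log ε|) := by
  obtain ⟨m, hm, hmΩ, hm2⟩ := exists_lattice_constant (div_pos hΩ₀ hε)
  have hK := one_le_densityBound Ω₀ μ
  set K := densityBound Ω₀ μ with hKdef
  set f : ℂ → ℝ := fun z => amplitudeSq Ω₀ μ ε m z * latticeSq m z with hf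
  have hfc : Continuous f := (continuous_amplitudeSq hε).mul (continuous_latticeSq m)
  have hf0 : ∀ z, 0 ≤ f z := fun z => mul_nonneg (amplitudeSq_pos hε z).le (latticeSq_nonneg m z)
  have hfK : ∀ z ∈ unitDisc, f z ≤ K := fun z hz => by
    refine le_trans ?_ (smoothDensity_le hε hε4 hz)
    have hW := latticeSq_add_pos hε m z
    have hs : 0 < smoothDensity Ω₀ μ ε z := smoothPos_pos hε _
    simp only [hf, amplitudeSq]
    rw [div_mul_eq_mul_div, div_le_iff₀ hW]
    nlinarith
  obtain ⟨hM, hTF⟩ := tfFunctional_normalize_le Ω₀ hfc (continuous_tfDensity Ω₀ μ) hK hf0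
    (tfDensity_nonneg Ω₀ μ) hfK (fun z hz => by linarith [tfDensity_add_one_le Ω₀ μ hz]) hμ
    (integral_abs_density_sub_le hε hε4 hm) hsmall
  set M := ∫ z, f z ∂discMeasure with hMdef
  have hMpos : 0 < M := by linarith
  set c := √M⁻¹ with hc
  have hc2 : c ^ 2 = M⁻¹ := Real.sq_sqrt (by positivity)
  have hc2' : c ^ 2 ≤ 2 := by
    rw [hc2, inv_le_comm₀ hMpos two_pos]; linarith
  set Ψ := trial Ω₀ μ ε (Ω₀ / ε) m c with hΨ
  have hΨd : Differentiable ℝ Ψ := differentiable_trial hε c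
  have hΨsq : ∀ z, ‖Ψ z‖ ^ 2 = M⁻¹ * f z := fun z => by rw [hΨ, norm_trial_sq hε, hc2]
  have hgc : Continuous fun z =>
      c ^ 2 * (Ω₀ ^ 4 / 8 / ε + 264 * (Real.pi * m) ^ 2 * amplitudeSq Ω₀ μ ε m z) := by
    have := continuous_amplitudeSq (Ω₀ := Ω₀) (μ := μ) (m := m) hε
    fun_prop
  have hmag : ∀ z ∈ unitDisc, magneticDensity (Ω₀ / ε) z (Ψ z) (fderiv ℝ Ψ z 1)
      (fderiv ℝ Ψ z Complex.I) ≤ c ^ 2 * (Ω₀ ^ 4 / 8 / ε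
        + 264 * (Real.pi * m) ^ 2 * amplitudeSq Ω₀ μ ε m z) :=
    fun z hz => magneticDensity_trial_le hε c hmΩ hz
  obtain ⟨B, hB⟩ := (isCompact_closedBall (0 : ℂ) 1).exists_bound_of_continuousOn
    hgc.continuousOn
  obtain ⟨B', hB'⟩ := (isCompact_closedBall (0 : ℂ) 1).exists_bound_of_continuousOn
    (hΨd.continuous.continuousOn)
  -- This bound may depend on `ε` in any way: it only places the trial function in `H¹`. It is read
  -- off from the covariant bound by removing the potential term.
  have hdb : ∀ z ∈ unitDisc, ‖fderiv ℝ Ψ z 1‖ ≤ (B + 1) + |Ω₀ / ε| * B' ∧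
      ‖fderiv ℝ Ψ z Complex.I‖ ≤ (B + 1) + |Ω₀ / ε| * B' := by
    intro z hz
    have hzc := Metric.ball_subset_closedBall hz
    have h1 := ((hmag z hz).trans (le_abs_self _)).trans (hB z hzc)
    have h2 := hB' z hzc
    have hz1 := norm_lt_one_of_mem hz
    unfold magneticDensity at h1
    have hterm : ∀ x : ℝ, |x| ≤ 1 → ‖Complex.I * (Ω₀ / ε / 2 * x : ℝ) * Ψ z‖
        ≤ |Ω₀ / ε| * B' := fun x hx => by
      rw [norm_mul, norm_mul, Complex.norm_I, Complex.norm_real, Real.norm_eq_abs, abs_mul,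
        abs_div _ 2, abs_two, one_mul]
      gcongr
      have := abs_nonneg (Ω₀ / ε)
      nlinarith [abs_nonneg x]
    have hsq : ∀ x y : ℝ, x ^ 2 + y ^ 2 ≤ B → x ≤ B + 1 ∧ y ≤ B + 1 := fun x y h =>
      ⟨by nlinarith [sq_nonneg (x - 1), sq_nonneg y], by nlinarith [sq_nonneg (y - 1), sq_nonneg x]⟩
    obtain ⟨h3, h4⟩ := hsq _ _ h1
    have h5 := hterm z.im ((Complex.abs_im_le_norm z).trans hz1.le)
    have h6 := hterm z.re ((Complex.abs_re_le_norm z).trans hz1.le)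
    constructor
    · have := norm_sub_le (fderiv ℝ Ψ z 1 + Complex.I * (Ω₀ / ε / 2 * z.im : ℝ) * Ψ z)
        (Complex.I * (Ω₀ / ε / 2 * z.im : ℝ) * Ψ z)
      rw [add_sub_cancel_right] at this
      linarith
    · have := norm_add_le (fderiv ℝ Ψ z Complex.I - Complex.I * (Ω₀ / ε / 2 * z.re : ℝ) * Ψ z)
        (Complex.I * (Ω₀ / ε / 2 * z.re : ℝ) * Ψ z)
      rw [sub_add_cancel] at this
      linarith
  set Φ := H1Disc.ofDifferentiable Ψ hΨd _ (fun z hz => (hdb z hz).1) (fun z hz => (hdb z hz).2)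
    with hΦ
  have hΦf : Φ.toFun = Ψ := rfl
  refine ⟨Φ, ?_, _, gpFunctional_eq hε Φ ?_, ?_⟩
  · simp only [hΦf, hΨsq]
    rw [integral_const_mul, inv_mul_cancel₀ hMpos.ne']
  · simp only [hΦf, hΨsq]
    exact (hfc.const_mul _).memLp_disc
  · have hkin : ∫ z, magneticDensity (Ω₀ / ε) z (Φ.toFun z) (Φ.dx z) (Φ.dy z) ∂discMeasure
        ≤ 2 * (Ω₀ ^ 4 / 8 / ε * 4 + 264 * (16 * m ^ 2) * (K * (24 * |Real.log ε|))) := by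
      have ha : Integrable (amplitudeSq Ω₀ μ ε m) discMeasure :=
        (continuous_amplitudeSq hε).integrable_disc
      have hi := (continuous_inv_latticeSq_add m hε).integrable_disc
      have h1 := integral_disc_mono (Φ.integrable_magneticDensity (Ω₀ / ε)) hgc.integrable_disc
        hmag
      rw [integral_const_mul, integral_add (integrable_const _) (ha.const_mul _),
        integral_const_mul, integral_const, discMeasure_real_univ, smul_eq_mul] at h1
      have h2 : ∫ z, amplitudeSq Ω₀ μ ε m z ∂discMeasure ≤ K * (24 * |Real.log ε|) := by
        have h3 := integral_disc_mono ha (hi.const_mul K) fun z hz => amplitudeSq_le hε hε4 hz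
        rw [integral_const_mul] at h3
        exact h3.trans (mul_le_mul_of_nonneg_left (integral_inv_latticeSq_le hm hε hε4)
          (by positivity))
      have h0 : 0 ≤ ∫ z, amplitudeSq Ω₀ μ ε m z ∂discMeasure :=
        integral_nonneg fun z => (amplitudeSq_pos hε z).le
      have hpi4 := Real.pi_le_four
      have hpisq : (Real.pi * m) ^ 2 ≤ 16 * m ^ 2 := by
        rw [mul_pow]
        gcongr
        nlinarith [Real.pi_pos]
      refine h1.trans ?_
      rw [mul_comm Real.pi (Ω₀ ^ 4 / 8 / ε)]
      gcongr
    have htf : tfFunctional Ω₀ (fun z => ‖Φ.toFun z‖ ^ 2)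
        ≤ tfFunctional Ω₀ (tfDensity Ω₀ μ)
          + (14 * K + 5 * (Ω₀ ^ 2 / 4)) * ((4 + 24 * K) * (ε * |Real.log ε|)) := by
      simp only [hΦf, hΨsq]
      exact hTF
    -- From `m² ≤ Ω₀/ε + 2` and `ε ≤ 1/4`.
    have hεm : ε * m ^ 2 ≤ Ω₀ + 1 := by
      have := mul_le_mul_of_nonneg_left hm2 hε.le
      rw [mul_add, mul_div_cancel₀ _ hε.ne'] at this
      linarith
    have hlog := le_mul_abs_log hε hε4
    have hk2 := mul_le_mul_of_nonneg_left hkin (sq_nonneg ε)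
    -- `202752 = 2 · 264 · 16 · 24`, with `m²` absorbed into the bounded quantity `ε m²`.
    have e1 : ε ^ 2 * (2 * (Ω₀ ^ 4 / 8 / ε * 4 + 264 * (16 * m ^ 2) * (K * (24 * |Real.log ε|))))
        = Ω₀ ^ 4 * ε + 202752 * K * (ε * m ^ 2) * (ε * |Real.log ε|) := by
      field_simp
      ring
    have h5 : Ω₀ ^ 4 * ε ≤ Ω₀ ^ 4 * (ε * |Real.log ε|) := by gcongr
    have h6 : 202752 * K * (ε * m ^ 2) * (ε * |Real.log ε|)
        ≤ 202752 * K * (Ω₀ + 1) * (ε * |Real.log ε|) := by gcongr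
    rw [mul_add, mul_div_cancel₀ _ (pow_ne_zero 2 hε.ne'), upperConst]
    linarith

end upper

/-! ### Two-sided bound on the ground state energy and conclusion. -/

lemma gpGroundStateEnergy_bounds {Ω₀ μ ε : ℝ} (hΩ₀ : 0 < Ω₀)
    (hμ : ∫ z, tfDensity Ω₀ μ z ∂discMeasure = 1) (hε : 0 < ε) (hε4 : ε ≤ 1 / 4)
    (hsmall : (4 + 24 * densityBound Ω₀ μ) * (ε * |Real.log ε|) ≤ 1 / 2) :
    ∃ E_GP : ℝ, gpGroundStateEnergy (Ω₀ / ε) ε = (E_GP : EReal) ∧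
      |ε ^ 2 * E_GP - tfFunctional Ω₀ (tfDensity Ω₀ μ)|
        ≤ upperConst Ω₀ μ * (ε * |Real.log ε|) := by
  have hleast := tfDensity_isLeast hμ
  obtain ⟨Ψ, hΨ, E, hE, hEle⟩ := exists_trial_energy hΩ₀ hμ hε hε4 hsmall
  have hup : gpGroundStateEnergy (Ω₀ / ε) ε ≤ (E : EReal) := sInf_le ⟨Ψ, hΨ, hE.symm⟩
  have hlow : ((tfFunctional Ω₀ (tfDensity Ω₀ μ) / ε ^ 2 : ℝ) : EReal)
      ≤ gpGroundStateEnergy (Ω₀ / ε) ε := by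
    refine le_sInf ?_
    rintro _ ⟨Φ, hΦ, rfl⟩
    exact le_gpFunctional hε hleast.2 Φ hΦ
  -- The infimum lies between two real numbers, hence is finite.
  have hne_top : gpGroundStateEnergy (Ω₀ / ε) ε ≠ ⊤ := (hup.trans_lt (EReal.coe_lt_top E)).ne
  have hne_bot : gpGroundStateEnergy (Ω₀ / ε) ε ≠ ⊥ :=
    ((EReal.bot_lt_coe _).trans_le hlow).ne'
  refine ⟨_, (EReal.coe_toReal hne_top hne_bot).symm, ?_⟩
  rw [← EReal.coe_toReal hne_top hne_bot, EReal.coe_le_coe_iff] at hup hlow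
  have h2 : 0 < ε ^ 2 := by positivity
  rw [div_le_iff₀ h2] at hlow
  have h3 := mul_le_mul_of_nonneg_left hup h2.le
  rw [abs_le]
  constructor <;> linarith

end RotatingCondensate

theorem mainTheorem1 (Ω₀ : ℝ) (hΩ₀ : 0 < Ω₀) :
    ∃ E_TF : ℝ, IsLeast (RotatingCondensate.tfValues Ω₀) E_TF ∧
      ∃ C : ℝ, 0 < C ∧ ∃ ε₀ : ℝ, 0 < ε₀ ∧ ∀ ε : ℝ, 0 < ε → ε < ε₀ →
        ∃ E_GP : ℝ, RotatingCondensate.gpGroundStateEnergy (Ω₀ / ε) ε = (E_GP : EReal) ∧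
          |ε ^ 2 * E_GP - E_TF| ≤ C * (ε * |Real.log ε|) := by
  obtain ⟨μ, hμ⟩ := RotatingCondensate.exists_tfDensity_mass Ω₀
  have hK := RotatingCondensate.one_le_densityBound Ω₀ μ
  refine ⟨_, RotatingCondensate.tfDensity_isLeast hμ, RotatingCondensate.upperConst Ω₀ μ,
    by unfold RotatingCondensate.upperConst; positivity, ?_⟩
  -- `ε log ε → 0` makes the `L¹` error of the trial density at most `1/2`, as its normalization
  -- requires.
  have hlim : Filter.Tendsto
      (fun ε : ℝ => (4 + 24 * RotatingCondensate.densityBound Ω₀ μ) * |ε * Real.log ε|)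
      (nhds 0) (nhds 0) := by
    have hc : Continuous fun ε : ℝ =>
        (4 + 24 * RotatingCondensate.densityBound Ω₀ μ) * |ε * Real.log ε| :=
      Real.continuous_mul_log.abs.const_mul _
    simpa using hc.tendsto 0
  obtain ⟨δ, hδ, hball⟩ := Metric.eventually_nhds_iff.1
    (hlim.eventually (ge_mem_nhds (by norm_num : (0 : ℝ) < 1 / 2)))
  refine ⟨min δ (1 / 4), by positivity, fun ε hε hεlt => ?_⟩
  refine RotatingCondensate.gpGroundStateEnergy_bounds hΩ₀ hμ hε (hεlt.le.trans (min_le_right _ _)) ?_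
  refine (le_of_eq ?_).trans (hball (y := ε) ?_)
  · rw [abs_mul, abs_of_pos hε]
  rw [Real.dist_eq, sub_zero, abs_of_pos hε]
  exact hεlt.trans_le (min_le_left _ _)
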